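/- Let $G$ be a finite group with exponent $n_1=2^m p_1^{m_1}\cdots p_r^{m_r}$ ($p_1,\dots,p_r$ distinct odd primes, $m\ge 0$, $m_j\ge 1$). For $g\in G$ let $A_g$ be the matrix with rows and columns indexed by $G$ and $(A_g)_{a,b}=1$ if $ba^{-1}=g$, $0$ otherwise; for $C\subseteq G$ put $A_C=\sum_{g\in C}A_g$. Let $\mathbb C[\mathcal A]$ be the Bose–Mesner algebra of the conjugacy class scheme of $G$, that is, the complex span of the matrices $A_K$, $K$ a conjugacy class. The Cayley digraph $X(G,C)$ has an arc from $a$ to $b$ iff $ba^{-1}\in C$; it is oriented if $C\cap C^{-1}=\emptyset$ and normal if $C$ is a union of conjugacy classes. Consider the integers $$\Delta=2^{w_0}(-1)^w\prod_{j=1}^r\bigl((-1)^{(p_j-1)/2}p_j\bigr)^{w_j},\qquad w_0,w,w_1,\dots,w_r\in\{0,1\},\quad w_0=0\text{ if }m<3,\quad w=0\text{ if }m<2,\tag{$*$}$$ and for each such $\Delta$ let $$H_\Delta=\Bigl\{k\in\mathbb Z_{n_1}^*:\ \chi(k)^{w_0}\Bigl(\tfrac{k}{4}\Bigr)^{w}\prod_{j=1}^r\Bigl(\tfrac{k}{p_j}\Bigr)^{w_j}=1\Bigr\},$$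 where $\chi$ is the character of $\mathbb Z_8^*$ with $\chi(1)=\chi(7)=1$, $\chi(3)=\chi(5)=-1$, $\left(\tfrac{k}{4}\right)=\pm1$ according as $k\equiv\pm1\pmod 4$, and $\left(\tfrac{k}{p_j}\right)$ is the Legendre symbol. Let $g\sim_\Delta h$ mean that $g$ is conjugate to $h^k$ for some $k\in H_\Delta$; this is an equivalence relation on $G$. **Feasible $\Delta$.** Let $\Delta_0$ be a square-free integer. Suppose that there is a $(0,1,-1)$-matrix in $\mathbb C[\mathcal A]$ all of whose eigenvalues lie in $\mathbb Q(\sqrt{\Delta_0})$ and, if $\Delta_0\ne1$, whose eigenvalues are not all rational. Then $\Delta_0$ is of the form $(*)$. Now take any $\Delta$ of the form $(*)$, and let $C_1,C_2$ be disjoint subsets of $G$ with $1\notin C_1\cup C_2$ and $M=A_{C_1}-A_{C_2}\in\mathbb C[\mathcal A]$. Then $C_1$ and $C_2$ are unions of conjugacy classes, and: (i) All eigenvalues of $M$ lie in $\mathbb Q(\sqrt\Delta)$ if and only if both $C_1$ and $C_2$ are unions of equivalence classes of $\sim_\Delta$. (ii) All eigenvalues of $M$ are integer multiples of $\sqrt\Delta$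 if and only if either - $\Delta=1$, and both $C_1$ and $C_2$ are unions of equivalence classes of $\sim_1$; or - $\Delta\ne1$, $C_2=C_1^k=\{g^k: g\in C_1\}$ for some $k\in\mathbb Z_{n_1}^*\setminus H_\Delta$, and $C_1$ is a union of equivalence classes of $\sim_\Delta$. Furthermore, suppose that all eigenvalues of $M$ are integer multiples of $\sqrt\Delta$. If $\Delta<0$, then $X(G,C_1)$ is an oriented normal Cayley graph and $M$ is its skew-symmetric $(1,-1,0)$ adjacency matrix. If $\Delta>0$, then $C_1=C_1^{-1}$, $C_2=C_2^{-1}$, and $M$ is the symmetric $(1,-1,0)$ adjacency matrix of the signed normal Cayley graph $X(G,C_1,C_2)$, whose positive edges come from $C_1$ and negative edges from $C_2$. If $M\neq0$, the converses of these two assertions also hold. -/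

import Mathlib

namespace NormalCayley

/-- The odd prime divisors `p₁, …, p_r` of `n`. -/
def oddPrimes (n : ℕ) : Finset ℕ := n.primeFactors.erase 2

/-- Exponents `w₀, w, w₁, …, w_r ∈ {0, 1}`, with `w₀ = 0` if `m < 3` and `w = 0` if `m < 2`, where
`2 ^ m` is the exact power of `2` dividing `n`. The exponent belonging to the odd prime `p` is
`wp p`; the values of `wp` at other arguments are never used. -/
structure DeltaParams (n : ℕ) where
  w₀ : ℕ
  w : ℕ
  wp : ℕ → ℕ
  w₀_le : w₀ ≤ 1
  w_le : w ≤ 1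
  wp_le : ∀ p, wp p ≤ 1
  w₀_eq : n.factorization 2 < 3 → w₀ = 0
  w_eq : n.factorization 2 < 2 → w = 0

namespace DeltaParams

variable {n : ℕ}

/-- `Δ = 2^{w₀} (-1)^w ∏ ((-1)^{(p-1)/2} p)^{w_p}`. -/
def delta (d : DeltaParams n) : ℤ :=
  2 ^ d.w₀ * (-1) ^ d.w * ∏ p ∈ oddPrimes n, ((-1) ^ ((p - 1) / 2) * (p : ℤ)) ^ d.wp p

/-- `χ(k)^{w₀} (k/4)^w ∏ (k/p)^{w_p}`, evaluated at the representative `0 ≤ k < n`. Here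
`ZMod.χ₈` is `1` on `1, 7` and `-1` on `3, 5`; `ZMod.χ₄` is `1` on `1` and `-1` on `3`; and for a
prime `p` the symbol `jacobiSym k p` is the Legendre symbol. -/
def sign (d : DeltaParams n) (k : (ZMod n)ˣ) : ℤ :=
  ZMod.χ₈ (((k : ZMod n).val : ℕ) : ZMod 8) ^ d.w₀ *
    ZMod.χ₄ (((k : ZMod n).val : ℕ) : ZMod 4) ^ d.w *
    ∏ p ∈ oddPrimes n, jacobiSym (((k : ZMod n).val : ℕ) : ℤ) p ^ d.wp p

theorem cast_val_mul {m : ℕ} [NeZero n] (h : m ∣ n) (a b : ZMod n) :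
    (((a * b).val : ℕ) : ZMod m) = (a.val : ZMod m) * (b.val : ZMod m) := by
  rw [ZMod.natCast_val, ZMod.natCast_val, ZMod.natCast_val, ZMod.cast_mul h]

theorem cast_val_one {m : ℕ} [NeZero n] (h : m ∣ n) :
    (((1 : ZMod n).val : ℕ) : ZMod m) = 1 := by
  rw [ZMod.natCast_val, ZMod.cast_one h]

theorem eight_dvd (d : DeltaParams n) (h : d.w₀ ≠ 0) : 8 ∣ n := by
  have h3 : 3 ≤ n.factorization 2 := by
    by_contra hc
    exact h (d.w₀_eq (by omega))
  exact (pow_dvd_pow 2 h3).trans (Nat.ordProj_dvd n 2)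

theorem four_dvd (d : DeltaParams n) (h : d.w ≠ 0) : 4 ∣ n := by
  have h2 : 2 ≤ n.factorization 2 := by
    by_contra hc
    exact h (d.w_eq (by omega))
  exact (pow_dvd_pow 2 h2).trans (Nat.ordProj_dvd n 2)

theorem sign_mul [NeZero n] (d : DeltaParams n) (a b : (ZMod n)ˣ) :
    d.sign (a * b) = d.sign a * d.sign b := by
  have e8 : ZMod.χ₈ (((((a * b : (ZMod n)ˣ) : ZMod n)).val : ℕ) : ZMod 8) ^ d.w₀ =
      ZMod.χ₈ (((a : ZMod n).val : ℕ) : ZMod 8) ^ d.w₀ *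
      ZMod.χ₈ (((b : ZMod n).val : ℕ) : ZMod 8) ^ d.w₀ := by
    by_cases h : d.w₀ = 0
    · simp [h]
    · rw [Units.val_mul, cast_val_mul (d.eight_dvd h), map_mul, mul_pow]
  have e4 : ZMod.χ₄ (((((a * b : (ZMod n)ˣ) : ZMod n)).val : ℕ) : ZMod 4) ^ d.w =
      ZMod.χ₄ (((a : ZMod n).val : ℕ) : ZMod 4) ^ d.w *
      ZMod.χ₄ (((b : ZMod n).val : ℕ) : ZMod 4) ^ d.w := by
    by_cases h : d.w = 0
    · simp [h]
    · rw [Units.val_mul, cast_val_mul (d.four_dvd h), map_mul, mul_pow]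
  have ep : ∀ p ∈ oddPrimes n,
      jacobiSym (((((a * b : (ZMod n)ˣ) : ZMod n)).val : ℕ) : ℤ) p ^ d.wp p =
      jacobiSym (((a : ZMod n).val : ℕ) : ℤ) p ^ d.wp p *
      jacobiSym (((b : ZMod n).val : ℕ) : ℤ) p ^ d.wp p := by
    intro p hp
    have hpn : p ∣ n := Nat.dvd_of_mem_primeFactors (Finset.mem_of_mem_erase hp)
    rw [← mul_pow, ← jacobiSym.mul_left]
    congr 1
    refine jacobiSym.mod_left' ?_
    have := cast_val_mul hpn (a : ZMod n) (b : ZMod n)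
    rw [Units.val_mul]
    exact (ZMod.intCast_eq_intCast_iff' _ _ p).1 (by exact_mod_cast this)
  unfold sign
  rw [e8, e4, Finset.prod_congr rfl ep, Finset.prod_mul_distrib]
  ring

theorem sign_one [NeZero n] (d : DeltaParams n) : d.sign 1 = 1 := by
  have e8 : ZMod.χ₈ (((((1 : (ZMod n)ˣ) : ZMod n)).val : ℕ) : ZMod 8) ^ d.w₀ = 1 := by
    by_cases h : d.w₀ = 0
    · simp [h]
    · rw [Units.val_one, cast_val_one (d.eight_dvd h), map_one, one_pow]
  have e4 : ZMod.χ₄ (((((1 : (ZMod n)ˣ) : ZMod n)).val : ℕ) : ZMod 4) ^ d.w = 1 := by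
    by_cases h : d.w = 0
    · simp [h]
    · rw [Units.val_one, cast_val_one (d.four_dvd h), map_one, one_pow]
  have ep : ∀ p ∈ oddPrimes n,
      jacobiSym (((((1 : (ZMod n)ˣ) : ZMod n)).val : ℕ) : ℤ) p ^ d.wp p = 1 := by
    intro p hp
    have hpn : p ∣ n := Nat.dvd_of_mem_primeFactors (Finset.mem_of_mem_erase hp)
    have h1 : jacobiSym (((((1 : (ZMod n)ˣ) : ZMod n)).val : ℕ) : ℤ) p = jacobiSym 1 p := by
      refine jacobiSym.mod_left' ?_
      have := cast_val_one (n := n) hpn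
      rw [Units.val_one]
      exact (ZMod.intCast_eq_intCast_iff' _ _ p).1 (by exact_mod_cast this)
    rw [h1, jacobiSym.one_left, one_pow]
  unfold sign
  rw [e8, e4, Finset.prod_congr rfl ep]
  simp

/-- The subgroup `H_Δ` of `(ℤ/n)ˣ`. -/
def H [NeZero n] (d : DeltaParams n) : Subgroup (ZMod n)ˣ where
  carrier := {k | d.sign k = 1}
  mul_mem' {a b} ha hb := by
    simp only [Set.mem_ofPred_eq] at *
    rw [sign_mul, ha, hb, one_mul]
  one_mem' := d.sign_one
  inv_mem' {a} ha := by
    simp only [Set.mem_ofPred_eq] at *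
    have h := d.sign_mul a a⁻¹
    rw [mul_inv_cancel, sign_one, ha, one_mul] at h
    exact h.symm

end DeltaParams

/-- The square root of the integer `D` in `ℂ`: `√D` if `D ≥ 0` and `i √|D|` if `D < 0`. -/
noncomputable def sqrtInt (D : ℤ) : ℂ :=
  if 0 ≤ D then (Real.sqrt (D : ℝ) : ℂ) else Complex.I * (Real.sqrt (-(D : ℝ)) : ℂ)

/-- The subfield `ℚ(√D)` of `ℂ`. -/
noncomputable def quadField (D : ℤ) : IntermediateField ℚ ℂ :=
  IntermediateField.adjoin ℚ {sqrtInt D}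

section Group

variable {G : Type*} [Group G]

instance exponent_neZero [Finite G] : NeZero (Monoid.exponent G) :=
  ⟨Monoid.exponent_ne_zero_of_finite⟩

/-- `g ^ k` for a residue class `k` modulo the exponent of the group. -/
noncomputable def powUnit (g : G) (k : (ZMod (Monoid.exponent G))ˣ) : G :=
  g ^ (k : ZMod (Monoid.exponent G)).val

theorem powUnit_one [Finite G] (g : G) : powUnit g 1 = g := by
  have h : ((1 : ZMod (Monoid.exponent G)).val) ≡ 1 [MOD Monoid.exponent G] := by
    rw [← ZMod.natCast_eq_natCast_iff]
    simp
  have h2 := (pow_eq_pow_iff_modEq (x := g)).2 (h.of_dvd (Monoid.order_dvd_exponent g))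
  simpa [powUnit] using h2

theorem powUnit_mul [Finite G] (g : G) (k l : (ZMod (Monoid.exponent G))ˣ) :
    powUnit g (k * l) = powUnit (powUnit g k) l := by
  have h : (((k * l : (ZMod (Monoid.exponent G))ˣ) : ZMod (Monoid.exponent G)).val) ≡
      (k : ZMod (Monoid.exponent G)).val * (l : ZMod (Monoid.exponent G)).val
      [MOD Monoid.exponent G] := by
    rw [← ZMod.natCast_eq_natCast_iff]
    simp
  have h2 := (pow_eq_pow_iff_modEq (x := g)).2 (h.of_dvd (Monoid.order_dvd_exponent g))
  simpa [powUnit, pow_mul] using h2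

theorem IsConj.powUnit {g h : G} (hc : IsConj g h) (k : (ZMod (Monoid.exponent G))ˣ) :
    IsConj (powUnit g k) (powUnit h k) := by
  rw [isConj_iff] at *
  obtain ⟨c, rfl⟩ := hc
  exact ⟨c, by simp [NormalCayley.powUnit, conj_pow]⟩

/-- The equivalence relation `∼_Δ`: `g ∼_Δ h` iff `g` and `h ^ k` are conjugate for some
`k ∈ H_Δ`. -/
def deltaSetoid [Finite G] (d : DeltaParams (Monoid.exponent G)) : Setoid G where
  r g h := ∃ k ∈ d.H, IsConj g (powUnit h k)
  iseqv :=
    { refl := fun g => ⟨1, d.H.one_mem, by rw [powUnit_one]⟩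
      symm := by
        rintro g h ⟨k, hk, hc⟩
        refine ⟨k⁻¹, d.H.inv_mem hk, ?_⟩
        have := (IsConj.powUnit hc k⁻¹).symm
        rwa [← powUnit_mul, mul_inv_cancel, powUnit_one] at this
      trans := by
        rintro a b c ⟨k, hk, hab⟩ ⟨l, hl, hbc⟩
        refine ⟨l * k, d.H.mul_mem hl hk, ?_⟩
        rw [powUnit_mul]
        exact hab.trans (IsConj.powUnit hbc k) }

/-- `C` is a union of equivalence classes of `r`. -/
def IsUnionOfClasses {X : Type*} (r : Setoid X) (C : Set X) : Prop :=
  ∃ S ⊆ r.classes, C = ⋃₀ S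

/-- `C` is a union of conjugacy classes of `G`. -/
def IsNormalSet (C : Set G) : Prop :=
  IsUnionOfClasses (IsConj.setoid G) C

/-- The permutation matrix `A_g`, with `(A_g)_{a,b} = 1` iff `b a⁻¹ = g`. -/
def groupMatrix [DecidableEq G] (g : G) : Matrix G G ℂ :=
  Matrix.of fun a b => if b * a⁻¹ = g then 1 else 0

/-- `A_C = ∑_{g ∈ C} A_g`. -/
def connMatrix [DecidableEq G] (C : Finset G) : Matrix G G ℂ :=
  ∑ g ∈ C, groupMatrix g

open Classical in
/-- The element `∑_{g ∈ K} A_g` of the conjugacy class scheme, `K` a conjugacy class. -/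
noncomputable def classMatrix [Fintype G] [DecidableEq G] (K : ConjClasses G) : Matrix G G ℂ :=
  connMatrix (Finset.univ.filter fun g => ConjClasses.mk g = K)

/-- The Bose-Mesner algebra `ℂ[𝒜]` of the conjugacy class scheme `𝒜` of `G`: the complex span of
the matrices of the scheme. -/
noncomputable def boseMesner (G : Type*) [Group G] [Fintype G] [DecidableEq G] :
    Submodule ℂ (Matrix G G ℂ) :=
  Submodule.span ℂ (Set.range (classMatrix (G := G)))

/-- The Cayley digraph `X(G, C)`: an arc from `g` to `h` iff `h g⁻¹ ∈ C`. -/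
def cayleyDigraph (C : Set G) : Digraph G where
  Adj g h := h * g⁻¹ ∈ C

/-- Conditions under which `X(G, C₁, C₂)` is a signed Cayley graph. -/
structure IsSignedPair (C₁ C₂ : Set G) : Prop where
  one_notMem : 1 ∉ C₁ ∪ C₂
  inv_mem_left : ∀ g ∈ C₁, g⁻¹ ∈ C₁
  inv_mem_right : ∀ g ∈ C₂, g⁻¹ ∈ C₂
  disj : Disjoint C₁ C₂

end Group

/-- `X` is an oriented graph: no loops, and no two opposite arcs. -/
def IsOriented {V : Type*} (X : Digraph V) : Prop :=
  ∀ u v, X.Adj u v → ¬ X.Adj v u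

open Classical in
/-- The skew-symmetric `(1, -1, 0)` adjacency matrix of an oriented graph. -/
noncomputable def skewAdjMatrix {V : Type*} (X : Digraph V) : Matrix V V ℂ :=
  Matrix.of fun u v => if X.Adj u v then 1 else if X.Adj v u then -1 else 0

/-- A signed graph, given by its positive and its negative edges. -/
structure SignedGraph (V : Type*) where
  pos : SimpleGraph V
  neg : SimpleGraph V
  disj : ∀ u v, pos.Adj u v → ¬ neg.Adj u v

open Classical in
/-- The symmetric `(1, -1, 0)` adjacency matrix of a signed graph. -/
noncomputable def SignedGraph.adjMatrix {V : Type*} (X : SignedGraph V) : Matrix V V ℂ :=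
  Matrix.of fun u v => if X.pos.Adj u v then 1 else if X.neg.Adj u v then -1 else 0

/-- The Cayley graph of an inverse-closed set that does not contain `1`. -/
def cayleyGraph {G : Type*} [Group G] (C : Set G) (h1 : 1 ∉ C) (hinv : ∀ g ∈ C, g⁻¹ ∈ C) :
    SimpleGraph G where
  Adj g h := h * g⁻¹ ∈ C
  symm := ⟨fun g h hgh => by simpa using hinv _ hgh⟩
  loopless := ⟨fun g hg => h1 (by simpa using hg)⟩

/-- The signed Cayley graph `X(G, C₁, C₂)`. -/
def signedCayleyGraph {G : Type*} [Group G] (C₁ C₂ : Set G) (h : IsSignedPair C₁ C₂) :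
    SignedGraph G where
  pos := cayleyGraph C₁ (fun h1 => h.one_notMem (Or.inl h1)) h.inv_mem_left
  neg := cayleyGraph C₂ (fun h1 => h.one_notMem (Or.inr h1)) h.inv_mem_right
  disj _ _ h1 h2 := Set.disjoint_left.1 h.disj h1 h2

/-- `X(G, C)` is an oriented Cayley graph with `C` a union of conjugacy classes, and `M` is its
skew-symmetric adjacency matrix. -/
def IsOrientedNormalCayleyMatrix {G : Type*} [Group G] (M : Matrix G G ℂ) (C : Set G) : Prop :=
  IsNormalSet C ∧ IsOriented (cayleyDigraph C) ∧ M = skewAdjMatrix (cayleyDigraph C)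

/-- `X(G, C₁, C₂)` is a signed Cayley graph with `C₁` and `C₂` unions of conjugacy classes, and `M`
is its symmetric adjacency matrix. -/
def IsSignedNormalCayleyMatrix {G : Type*} [Group G] (M : Matrix G G ℂ) (C₁ C₂ : Set G) : Prop :=
  IsNormalSet C₁ ∧ IsNormalSet C₂ ∧
    ∃ h : IsSignedPair C₁ C₂, M = (signedCayleyGraph C₁ C₂ h).adjMatrix

end NormalCayley

open NormalCayley

/-! Let `n` be the exponent of `G`, `K` the `n`-th cyclotomic field and `c` a rational class
function on `G`. All eigenvalues of `∑ c(g) A_g` lie in `K`, and the automorphism `k ∈ (ℤ/n)ˣ` turns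
them into the eigenvalues of `∑ c(g) A_{g^k}` on the same joint eigenvectors. No character table is
needed for this. On a joint eigenspace `W` of the two matrices every `A_g` acts, with order dividing
`n`. The trace of `A_g` on `W` is therefore a sum of `n`-th roots of unity, and raising those to the
power `k` gives the trace of `A_{g^k}`; dividing by `dim W` recovers the eigenvalues
(`exists_map_eq_eigenvalue`).

A class function is determined by the action of its matrix on joint eigenvectors
(`eq_smul_of_joint_eigenvalues`). So `k` fixes (negates) all eigenvalues iff `g ↦ g^k` preserves
(negates) `c`: this is `forall_cyclotomicAut_eq_iff`.

Gauss sums, `i` and `√2` provide a square root of `Δ` in `K` on which `k` acts by the sign defining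
`H_Δ`. By Galois theory, eigenvalues lie in `ℚ(√Δ)` iff `H_Δ` fixes them. Since they are algebraic
integers and `Δ` is squarefree, they are integer multiples of `√Δ` iff, moreover, the complement of
`H_Δ` negates them. Translating to `c = 1_{C₁} - 1_{C₂}` gives (i) and (ii). As complex conjugation
is the automorphism `-1`, the sign of `Δ` decides whether inversion preserves or negates `c`.

For feasibility, an irrational eigenvalue in `ℚ(√D)` puts `√D` into `K`. A unit on which all
quadratic characters are trivial is a square modulo `n` (Hensel and the Chinese remainder theorem),
hence fixes `√D`. So `√D` times some of the basic square roots is rational, which forces `D = Δ` for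
some choice of exponents. -/

namespace NormalCayley

open IsCyclotomicExtension.Rat

/-! ### Galois action on the cyclotomic field and its basic square roots -/

section Field

variable {n : ℕ} [NeZero n] {K : Type*} [Field K] [NumberField K] [IsCyclotomicExtension {n} ℚ K]

/-- The automorphism of the `n`-th cyclotomic field that raises the `n`-th roots of unity to the
power `k`. -/
noncomputable def cyclotomicAut (K : Type*) [Field K] [NumberField K]
    [IsCyclotomicExtension {n} ℚ K] (k : (ZMod n)ˣ) : K ≃ₐ[ℚ] K :=
  (galEquivZMod n K).symm k

theorem cyclotomicAut_surjective (σ : K ≃ₐ[ℚ] K) : ∃ k : (ZMod n)ˣ, cyclotomicAut K k = σ :=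
  ⟨galEquivZMod n K σ, (galEquivZMod n K).symm_apply_apply σ⟩

theorem cyclotomicAut_mul (k l : (ZMod n)ˣ) (x : K) :
    cyclotomicAut K (k * l) x = cyclotomicAut K k (cyclotomicAut K l x) := by
  rw [cyclotomicAut, map_mul]
  rfl

theorem cyclotomicAut_root (k : (ZMod n)ˣ) {x : K} (hx : x ^ n = 1) :
    cyclotomicAut K k x = x ^ (k : ZMod n).val := by
  have h := galEquivZMod_apply_of_pow_eq n K ((galEquivZMod n K).symm k) hx
  rwa [(galEquivZMod n K).apply_symm_apply] at h

theorem exists_rat_of_fixed {x : K} (h : ∀ k : (ZMod n)ˣ, cyclotomicAut K k x = x) :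
    ∃ q : ℚ, x = q := by
  have : IsGalois ℚ K := IsCyclotomicExtension.isGalois {n} ℚ K
  have h2 := (IsGalois.mem_bot_iff_fixed (F := ℚ) (E := K) x).2 (fun f => by
    obtain ⟨k, rfl⟩ := cyclotomicAut_surjective (n := n) f
    exact h k)
  obtain ⟨q, hq⟩ := IntermediateField.mem_bot.1 h2
  exact ⟨q, by rw [← hq]; simp⟩

variable (K) in
theorem exists_primitiveRoot {m : ℕ} (h : m ∣ n) :
    ∃ z : K, IsPrimitiveRoot z m ∧ z ^ n = 1 := by
  have hz := IsCyclotomicExtension.zeta_spec n ℚ K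
  obtain ⟨t, ht⟩ := h
  refine ⟨IsCyclotomicExtension.zeta n ℚ K ^ t, hz.pow (NeZero.pos n) (by rw [ht, mul_comm]), ?_⟩
  rw [← pow_mul, mul_comm, pow_mul, hz.pow_eq_one, one_pow]

-- The square root is the quadratic Gauss sum: its square is `χ(-1) p`, and the automorphism `k`
-- shifts the additive character by `k`, which multiplies the sum by `χ(k)`.
variable (K) in
theorem exists_sqrt_oddPrime {p : ℕ} (hp : p ∈ oddPrimes n) :
    ∃ a : K, a ^ 2 = (((-1) ^ ((p - 1) / 2) * (p : ℤ) : ℤ) : K) ∧ ∀ k : (ZMod n)ˣ,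
      cyclotomicAut K k a = (jacobiSym (((k : ZMod n).val : ℕ) : ℤ) p : K) * a := by
  have hpp : p.Prime := Nat.prime_of_mem_primeFactors (Finset.mem_of_mem_erase hp)
  have hpn : p ∣ n := Nat.dvd_of_mem_primeFactors (Finset.mem_of_mem_erase hp)
  have hp2 : p ≠ 2 := Finset.ne_of_mem_erase hp
  have : Fact p.Prime := ⟨hpp⟩
  obtain ⟨z, hz, hzn⟩ := exists_primitiveRoot K hpn
  have hchar : ringChar (ZMod p) ≠ 2 := by rwa [ZMod.ringChar_zmod_n]
  have hinj : Function.Injective (Int.castRingHom K) := Int.cast_injective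
  set χ : MulChar (ZMod p) K := (quadraticChar (ZMod p)).ringHomComp (Int.castRingHom K) with hχ
  have hχ1 : χ ≠ 1 := (MulChar.ringHomComp_ne_one_iff hinj).2 (quadraticChar_ne_one hchar)
  have hχ2 : χ.IsQuadratic := (quadraticChar_isQuadratic (ZMod p)).comp _
  set ψ : AddChar (ZMod p) K := AddChar.zmodChar p hz.pow_eq_one with hψ
  have hprim : ψ.IsPrimitive := AddChar.zmodChar_primitive_of_primitive_root p hz
  refine ⟨gaussSum χ ψ, ?_, fun k => ?_⟩
  · rw [gaussSum_sq hχ1 hχ2 hprim, ZMod.card, hχ, MulChar.ringHomComp_apply,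
      quadraticChar_neg_one hchar, ZMod.card,
      ZMod.χ₄_eq_neg_one_pow (hpp.mod_two_eq_one_iff_ne_two.2 hp2)]
    have : p / 2 = (p - 1) / 2 := by
      have := hpp.mod_two_eq_one_iff_ne_two.2 hp2
      omega
    rw [this]
    push_cast
    simp
  · set l : (ZMod p)ˣ := ZMod.unitsMap hpn k with hl
    have hlk : (l : ZMod p) = (((k : ZMod n).val : ℕ) : ZMod p) := by
      rw [hl, ZMod.unitsMap_val, ZMod.natCast_val]
    have h1 : cyclotomicAut K k (gaussSum χ ψ) = gaussSum χ (ψ.mulShift l) := by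
      unfold gaussSum
      rw [map_sum]
      refine Finset.sum_congr rfl fun x _ => ?_
      rw [map_mul, AddChar.mulShift_apply, hχ, MulChar.ringHomComp_apply, Int.coe_castRingHom,
        map_intCast]
      congr 1
      rw [hψ, AddChar.zmodChar_apply, map_pow, cyclotomicAut_root k hzn, ← pow_mul, hlk]
      conv_rhs => rw [← ZMod.natCast_zmod_val x, ← Nat.cast_mul]
      rw [AddChar.zmodChar_apply']
    have h2 := gaussSum_mulShift χ ψ l
    have h3 : χ l = (jacobiSym (((k : ZMod n).val : ℕ) : ℤ) p : K) := by
      rw [← jacobiSym.legendreSym.to_jacobiSym, hχ, MulChar.ringHomComp_apply, hlk]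
      simp [legendreSym]
    have h4 : χ l * χ l = 1 := by
      rw [← pow_two, ← MulChar.pow_apply_coe, hχ2.sq_eq_one, MulChar.one_apply_coe]
    rw [h1, ← h3]
    -- `gaussSum_mulShift` has the factor `χ l` on the shifted side; `χ l` is its own inverse, so it
    -- can be moved across.
    calc _ = (χ l * χ l) * gaussSum χ (ψ.mulShift l) := by rw [h4, one_mul]
      _ = _ := by rw [mul_assoc, h2]

variable (K) in
theorem exists_sqrt_neg_one (h : 4 ∣ n) :
    ∃ a : K, a ^ 2 = ((-1 : ℤ) : K) ∧ ∀ k : (ZMod n)ˣ,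
      cyclotomicAut K k a = (ZMod.χ₄ (((k : ZMod n).val : ℕ) : ZMod 4) : K) * a := by
  obtain ⟨z, hz, hzn⟩ := exists_primitiveRoot K h
  have h2 : z ^ 2 = -1 := by
    have := (hz.pow (by norm_num : 0 < 4) (by norm_num : 4 = 2 * 2)).eq_neg_one_of_two_right
    exact this
  refine ⟨z, by simpa using h2, fun k => ?_⟩
  rw [cyclotomicAut_root k hzn]
  have hodd : (k : ZMod n).val % 2 = 1 := by
    have := ZMod.val_coe_unit_coprime k
    have h3 : ((k : ZMod n).val).Coprime 2 := this.coprime_dvd_right (Dvd.dvd.trans (by norm_num) h)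
    exact Nat.odd_iff.1 (Nat.coprime_two_right.1 h3)
  rw [ZMod.χ₄_eq_neg_one_pow hodd]
  conv_lhs => rw [← Nat.div_add_mod (k : ZMod n).val 2, hodd, pow_add, pow_mul, h2]
  push_cast
  ring

variable (K) in
theorem exists_sqrt_two (h : 8 ∣ n) :
    ∃ a : K, a ^ 2 = ((2 : ℤ) : K) ∧ ∀ k : (ZMod n)ˣ,
      cyclotomicAut K k a = (ZMod.χ₈ (((k : ZMod n).val : ℕ) : ZMod 8) : K) * a := by
  obtain ⟨z, hz, hzn⟩ := exists_primitiveRoot K h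
  have h4 : z ^ 4 = -1 :=
    (hz.pow (by norm_num : 0 < 8) (by norm_num : 8 = 4 * 2)).eq_neg_one_of_two_right
  have h8 := hz.pow_eq_one
  -- For a primitive eighth root `z` one has `z⁻¹ = -z ^ 3`, so this is `z + z⁻¹`.
  refine ⟨z - z ^ 3, ?_, fun k => ?_⟩
  · push_cast
    linear_combination (z ^ 2 - 2) * h4
  rw [map_sub, map_pow, cyclotomicAut_root k hzn]
  have hodd : (k : ZMod n).val % 2 = 1 := by
    have := ZMod.val_coe_unit_coprime k
    have h3 : ((k : ZMod n).val).Coprime 2 := this.coprime_dvd_right (Dvd.dvd.trans (by norm_num) h)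
    exact Nat.odd_iff.1 (Nat.coprime_two_right.1 h3)
  have hred : z ^ (k : ZMod n).val = z ^ ((k : ZMod n).val % 8) := by
    conv_lhs => rw [← Nat.div_add_mod (k : ZMod n).val 8, pow_add, pow_mul, h8, one_pow, one_mul]
  rw [hred, ← ZMod.natCast_mod]
  have hlt : (k : ZMod n).val % 8 < 8 := Nat.mod_lt _ (by norm_num)
  have hodd' : (k : ZMod n).val % 8 % 2 = 1 := by omega
  generalize (k : ZMod n).val % 8 = j at *
  have c1 : ZMod.χ₈ ((1 : ℕ) : ZMod 8) = 1 := by decide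
  have c3 : ZMod.χ₈ ((3 : ℕ) : ZMod 8) = -1 := by decide
  have c5 : ZMod.χ₈ ((5 : ℕ) : ZMod 8) = -1 := by decide
  have c7 : ZMod.χ₈ ((7 : ℕ) : ZMod 8) = 1 := by decide
  -- Only the odd residues survive; in each case the coefficient of `h4` is the quotient of the
  -- difference of the two sides by `z ^ 4 + 1`.
  interval_cases j
  all_goals first | omega | skip
  · rw [c1]; push_cast; ring
  · rw [c3]; push_cast; linear_combination -z * (z ^ 4 - 1) * h4
  · rw [c5]; push_cast; linear_combination (z - z ^ 3 * (z ^ 8 - z ^ 4 + 1)) * h4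
  · rw [c7]; push_cast
    linear_combination (z ^ 3 - z * (z ^ 16 - z ^ 12 + z ^ 8 - z ^ 4 + 1)) * h4

end Field

/-! ### Kummer-type argument for square roots -/

/-- Field elements on which the automorphisms act by signs: if every automorphism fixing all `a i` fixes `x`, then `x`
times a product of some of the `a i` is fixed by the whole group. -/
theorem exists_prod_fixed_of_sign {K : Type*} [Field K] [Algebra ℚ K] {ι : Type*}
    [DecidableEq ι] (a : ι → K) (s : Finset ι)
    (ha : ∀ i ∈ s, ∀ σ : K ≃ₐ[ℚ] K, σ (a i) = a i ∨ σ (a i) = -a i) :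
    ∀ x : K, (∀ σ : K ≃ₐ[ℚ] K, σ x = x ∨ σ x = -x) →
      (∀ σ : K ≃ₐ[ℚ] K, (∀ i ∈ s, σ (a i) = a i) → σ x = x) →
      ∃ w : ι → ℕ, (∀ i, w i ≤ 1) ∧ ∀ σ : K ≃ₐ[ℚ] K, σ (x * ∏ i ∈ s, a i ^ w i) =
        x * ∏ i ∈ s, a i ^ w i := by
  induction s using Finset.induction_on with
  | empty =>
    intro x _ h
    exact ⟨0, by simp, fun σ => by simpa using h σ (by simp)⟩
  | insert j s hj ih =>
    intro x hx h
    have ih' := ih fun i hi => ha i (Finset.mem_insert_of_mem hi)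
    by_cases hc : ∀ σ : K ≃ₐ[ℚ] K, (∀ i ∈ s, σ (a i) = a i) → σ x = x
    · obtain ⟨w, hw, hf⟩ := ih' x hx hc
      have e : ∏ i ∈ insert j s, a i ^ (Function.update w j 0) i = ∏ i ∈ s, a i ^ w i := by
        rw [Finset.prod_insert hj]
        simp only [Function.update_self, pow_zero, one_mul]
        refine Finset.prod_congr rfl fun i hi => ?_
        rw [Function.update_of_ne (by rintro rfl; exact hj hi)]
      refine ⟨Function.update w j 0, fun i => ?_, fun σ => by rw [e]; exact hf σ⟩
      by_cases hij : i = j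
      · subst hij; simp
      · rw [Function.update_of_ne hij]; exact hw i
    · push Not at hc
      obtain ⟨τ, hτ, hτx⟩ := hc
      have hτx' : τ x = -x := (hx τ).resolve_left hτx
      have haj : ∀ σ : K ≃ₐ[ℚ] K, σ (a j) = a j ∨ σ (a j) = -a j :=
        ha j (Finset.mem_insert_self _ _)
      have hτj : τ (a j) = -a j := (haj τ).resolve_left fun hh => hτx (h τ (by
        intro i hi
        rcases Finset.mem_insert.1 hi with rfl | hi
        · exact hh
        · exact hτ i hi))
      -- Here `τ` fixes the `a i` with `i ∈ s` but negates `x`, so it must negate `a j`; hence `x *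
      -- a j` satisfies the hypothesis for the smaller set `s`.
      obtain ⟨w, hw, hf⟩ := ih' (x * a j) (fun σ => by
          rw [map_mul]
          rcases hx σ with h1 | h1 <;> rcases haj σ with h2 | h2 <;> rw [h1, h2] <;> simp)
        (fun σ hσ => by
          rw [map_mul]
          rcases haj σ with h2 | h2
          · rw [h2, h σ]
            intro i hi
            rcases Finset.mem_insert.1 hi with rfl | hi
            · exact h2
            · exact hσ i hi
          -- If `σ` negates `a j`, then `σ τ` fixes every `a i`, hence `x`; as `τ x = -x`, also `σ x
          -- = -x`, and the signs on `x` and `a j` cancel.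
          · have h3 := h (σ * τ) (fun i hi => by
              rcases Finset.mem_insert.1 hi with rfl | hi
              · rw [AlgEquiv.mul_apply, hτj, map_neg, h2, neg_neg]
              · rw [AlgEquiv.mul_apply, hτ i hi, hσ i hi])
            rw [AlgEquiv.mul_apply, hτx', map_neg] at h3
            rw [h2, mul_neg, ← neg_mul, h3])
      have e : x * ∏ i ∈ insert j s, a i ^ (Function.update w j 1) i =
          x * a j * ∏ i ∈ s, a i ^ w i := by
        rw [Finset.prod_insert hj, mul_assoc]
        simp only [Function.update_self, pow_one]
        congr 2
        refine Finset.prod_congr rfl fun i hi => ?_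
        rw [Function.update_of_ne (by rintro rfl; exact hj hi)]
      refine ⟨Function.update w j 1, fun i => ?_, fun σ => by rw [e]; exact hf σ⟩
      by_cases hij : i = j
      · subst hij; simp
      · rw [Function.update_of_ne hij]; exact hw i

/-! ### Squares modulo `n` -/

-- Hensel's lemma for `X ^ 2 - k` at `x` yields a square root of `k` in `ℤ_[p]`, which is then
-- reduced modulo `p ^ j`.
open Polynomial in
theorem isSquare_zmod_prime_pow {p : ℕ} [Fact p.Prime] {x k : ℤ}
    (h : ‖((x ^ 2 - k : ℤ) : ℤ_[p])‖ < ‖((2 * x : ℤ) : ℤ_[p])‖ ^ 2) (j : ℕ) :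
    IsSquare (k : ZMod (p ^ j)) := by
  have h1 : ‖(aeval ((x : ℤ) : ℤ_[p])) (X ^ 2 - C k : ℤ[X])‖ <
      ‖(aeval ((x : ℤ) : ℤ_[p])) (derivative (X ^ 2 - C k : ℤ[X]))‖ ^ 2 := by
    have e1 : (aeval ((x : ℤ) : ℤ_[p])) (X ^ 2 - C k : ℤ[X]) = ((x ^ 2 - k : ℤ) : ℤ_[p]) := by
      simp
    have e2 : (aeval ((x : ℤ) : ℤ_[p])) (derivative (X ^ 2 - C k : ℤ[X])) =
        ((2 * x : ℤ) : ℤ_[p]) := by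
      simp
      exact Or.inl (map_ofNat _ 2)
    rwa [e1, e2]
  obtain ⟨z, hz, -⟩ := hensels_lemma h1
  have hz' : z ^ 2 = (k : ℤ_[p]) := by
    simpa [sub_eq_zero] using hz
  refine ⟨PadicInt.toZModPow j z, ?_⟩
  rw [← map_mul, ← pow_two, hz', map_intCast]

theorem mod_two_eq_sq : ∀ x : ZMod 2, x = x * x := by decide

/-- A residue class that is a square modulo the odd primes dividing `n`, modulo `4` if `4 ∣ n` and
modulo `8` if `8 ∣ n` is a square modulo `n`. -/
theorem isSquare_zmod {n : ℕ} [NeZero n] {k : ℕ} (hk : k.Coprime n)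
    (hodd : ∀ p ∈ oddPrimes n, jacobiSym (k : ℤ) p = 1) (h4 : 4 ∣ n → k % 4 = 1)
    (h8 : 8 ∣ n → k % 8 = 1) : IsSquare (k : ZMod n) := by
  suffices H : ∀ m : ℕ, m ≠ 0 → m ∣ n → IsSquare (k : ZMod m) from H n (NeZero.ne n) dvd_rfl
  intro m
  induction m using Nat.recOnPrimeCoprime with
  | zero => intro h; exact absurd rfl h
  | prime_pow p j hp =>
    intro _ hm
    have : Fact p.Prime := ⟨hp⟩
    rcases Nat.eq_zero_or_pos j with rfl | hj
    · exact ⟨0, Subsingleton.elim (α := ZMod 1) _ _⟩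
    have hpn : p ∣ n := (dvd_pow_self p hj.ne').trans hm
    rcases eq_or_ne p 2 with rfl | hp2
    · rcases (by omega : j = 1 ∨ j = 2 ∨ 3 ≤ j) with rfl | rfl | h3
      · exact ⟨k, mod_two_eq_sq _⟩
      · refine ⟨1, ?_⟩
        have := h4 hm
        rw [mul_one, ← Nat.cast_one]
        exact (ZMod.natCast_eq_natCast_iff' _ _ _).2 (by norm_num [this])
      · have h81 := h8 ((pow_dvd_pow 2 h3).trans hm)
        have key : IsSquare ((k : ℤ) : ZMod (2 ^ j)) := by
          -- The derivative at `1` has norm `1/2`, so Hensel needs `|1 - k| < 1/4`; `k ≡ 1` modulo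
          -- `8` gives `1/8`.
          refine isSquare_zmod_prime_pow (x := 1) ?_ j
          have a1 : ‖((1 ^ 2 - (k : ℤ) : ℤ) : ℤ_[2])‖ ≤ ((2 : ℕ) : ℝ) ^ (-((3 : ℕ) : ℤ)) :=
            PadicInt.norm_int_le_pow_iff_dvd.2 (by norm_num; omega)
          have a2 : ‖((2 * 1 : ℤ) : ℤ_[2])‖ = 2⁻¹ := by
            have := PadicInt.norm_p (p := 2)
            simpa using this
          rw [a2]
          exact lt_of_le_of_lt a1 (by norm_num)
        simpa using key
    · have hmem : p ∈ oddPrimes n :=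
        Finset.mem_erase.2 ⟨hp2, Nat.mem_primeFactors.2 ⟨hp, hpn, NeZero.ne n⟩⟩
      have hkp : k.Coprime p := hk.coprime_dvd_right hpn
      have hk0 : ((k : ℤ) : ZMod p) ≠ 0 := by
        intro h0
        have h0' : (k : ZMod p) = 0 := by simpa using h0
        have := (ZMod.natCast_eq_zero_iff k p).1 h0'
        exact hp.one_lt.ne' (Nat.eq_one_of_dvd_coprimes hkp this dvd_rfl)
      have hl := hodd p hmem
      rw [← jacobiSym.legendreSym.to_jacobiSym, legendreSym.eq_one_iff p hk0] at hl
      obtain ⟨y, hy⟩ := hl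
      obtain ⟨x, rfl⟩ := ZMod.intCast_surjective y
      have key : IsSquare ((k : ℤ) : ZMod (p ^ j)) := by
        refine isSquare_zmod_prime_pow (x := x) ?_ j
        have b1 : ‖((x ^ 2 - (k : ℤ) : ℤ) : ℤ_[p])‖ < 1 := by
          rw [PadicInt.norm_int_lt_one_iff_dvd, ← ZMod.intCast_zmod_eq_zero_iff_dvd]
          push_cast at hy ⊢
          rw [hy]
          ring
        have b2 : ‖((2 * x : ℤ) : ℤ_[p])‖ = 1 := by
          refine le_antisymm (PadicInt.norm_le_one _) (not_lt.1 fun hlt => ?_)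
          rw [PadicInt.norm_int_lt_one_iff_dvd] at hlt
          rcases (Nat.prime_iff_prime_int.1 hp).dvd_or_dvd hlt with h | h
          · exact hp2 ((Nat.prime_dvd_prime_iff_eq hp Nat.prime_two).1 (by exact_mod_cast h))
          · rw [← ZMod.intCast_zmod_eq_zero_iff_dvd] at h
            exact hk0 (by rw [hy, h, mul_zero])
        rw [b2, one_pow]
        exact b1
      simpa using key
  | coprime a b ha hb hab iha ihb =>
    intro _ hm
    obtain ⟨x, hx⟩ := iha (by omega) ((dvd_mul_right a b).trans hm)
    obtain ⟨y, hy⟩ := ihb (by omega) ((dvd_mul_left b a).trans hm)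
    have h : IsSquare ((k : ZMod a × ZMod b)) := ⟨(x, y), by ext <;> simp [hx, hy]⟩
    simpa using h.map (ZMod.chineseRemainder hab).symm

/-! ### Uniform indexing of the factors of `Δ` and of its character -/

/-- Indices of the quadratic characters modulo `n`: the odd primes dividing `n`, and `4` and `8` if
they divide `n`. -/
def quadIndices (n : ℕ) : Finset ℕ := oddPrimes n ∪ ({4, 8} : Finset ℕ).filter (· ∣ n)

/-- The integer whose square root generates the quadratic field of the character `q`. -/
def quadDisc (q : ℕ) : ℤ := if q = 4 then -1 else if q = 8 then 2 else (-1) ^ ((q - 1) / 2) * q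

/-- The quadratic character with index `q`. -/
def quadSign (q k : ℕ) : ℤ :=
  if q = 4 then ZMod.χ₄ (k : ZMod 4) else if q = 8 then ZMod.χ₈ (k : ZMod 8) else jacobiSym k q

theorem oddPrimes_prime {n p : ℕ} (hp : p ∈ oddPrimes n) : p.Prime :=
  Nat.prime_of_mem_primeFactors (Finset.mem_of_mem_erase hp)

theorem oddPrimes_ne_four {n p : ℕ} (hp : p ∈ oddPrimes n) : p ≠ 4 := by
  rintro rfl
  exact absurd (oddPrimes_prime hp) (by norm_num)

theorem oddPrimes_ne_eight {n p : ℕ} (hp : p ∈ oddPrimes n) : p ≠ 8 := by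
  rintro rfl
  exact absurd (oddPrimes_prime hp) (by norm_num)

theorem mem_quadIndices {n q : ℕ} :
    q ∈ quadIndices n ↔ q ∈ oddPrimes n ∨ (q = 4 ∧ 4 ∣ n) ∨ (q = 8 ∧ 8 ∣ n) := by
  simp only [quadIndices, Finset.mem_union, Finset.mem_filter, Finset.mem_insert,
    Finset.mem_singleton]
  constructor
  · rintro (h | ⟨rfl | rfl, h⟩) <;> simp_all
  · rintro (h | ⟨rfl, h⟩ | ⟨rfl, h⟩) <;> simp_all

theorem prod_quadIndices {R : Type*} [CommMonoid R] (n : ℕ) (f : ℕ → R) :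
    ∏ q ∈ quadIndices n, f q =
      (if 8 ∣ n then f 8 else 1) * (if 4 ∣ n then f 4 else 1) * ∏ p ∈ oddPrimes n, f p := by
  have hd : Disjoint (oddPrimes n) (({4, 8} : Finset ℕ).filter (· ∣ n)) := by
    rw [Finset.disjoint_left]
    intro q hq hq'
    have := (Finset.mem_filter.1 hq').1
    rcases Finset.mem_insert.1 this with h | h
    · exact oddPrimes_ne_four hq h
    · exact oddPrimes_ne_eight hq (Finset.mem_singleton.1 h)
  rw [quadIndices, Finset.prod_union hd, Finset.prod_filter, Finset.prod_pair (by norm_num),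
    mul_comm, mul_comm (if 4 ∣ n then f 4 else 1)]

namespace DeltaParams

variable {n : ℕ}

/-- The exponent belonging to the index `q`. -/
def exp (d : DeltaParams n) (q : ℕ) : ℕ := if q = 4 then d.w else if q = 8 then d.w₀ else d.wp q

theorem exp_le (d : DeltaParams n) (q : ℕ) : d.exp q ≤ 1 := by
  unfold exp
  split_ifs
  exacts [d.w_le, d.w₀_le, d.wp_le q]

/-- The factors at `4` and `8` may be absent from the index set, but then `w` or `w₀` is zero and
the corresponding power is `1`. -/
theorem prod_exp {R : Type*} [CommMonoid R] (d : DeltaParams n) (f : ℕ → R) :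
    ∏ q ∈ quadIndices n, f q ^ d.exp q =
      f 8 ^ d.w₀ * f 4 ^ d.w * ∏ p ∈ oddPrimes n, f p ^ d.wp p := by
  rw [prod_quadIndices]
  congr 1
  · congr 1
    · split_ifs with h
      · simp [exp]
      · rw [not_not.1 (mt d.eight_dvd h), pow_zero]
    · split_ifs with h
      · simp [exp]
      · rw [not_not.1 (mt d.four_dvd h), pow_zero]
  · refine Finset.prod_congr rfl fun p hp => ?_
    rw [exp, if_neg (oddPrimes_ne_four hp), if_neg (oddPrimes_ne_eight hp)]

theorem delta_eq_prod (d : DeltaParams n) :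
    d.delta = ∏ q ∈ quadIndices n, quadDisc q ^ d.exp q := by
  rw [prod_exp, delta]
  congr 1
  refine Finset.prod_congr rfl fun p hp => ?_
  rw [quadDisc, if_neg (oddPrimes_ne_four hp), if_neg (oddPrimes_ne_eight hp)]

theorem sign_eq_prod (d : DeltaParams n) (k : (ZMod n)ˣ) :
    d.sign k = ∏ q ∈ quadIndices n, quadSign q (k : ZMod n).val ^ d.exp q := by
  rw [prod_exp d (fun q => quadSign q (k : ZMod n).val), sign]
  congr 1
  refine Finset.prod_congr rfl fun p hp => ?_
  rw [quadSign, if_neg (oddPrimes_ne_four hp), if_neg (oddPrimes_ne_eight hp)]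

/-- The parameters with given exponents. -/
def ofExp [NeZero n] (w : ℕ → ℕ) (hw : ∀ q, w q ≤ 1) : DeltaParams n where
  w₀ := if 8 ∣ n then w 8 else 0
  w := if 4 ∣ n then w 4 else 0
  wp := w
  w₀_le := by split_ifs; exacts [hw 8, zero_le_one]
  w_le := by split_ifs; exacts [hw 4, zero_le_one]
  wp_le := hw
  w₀_eq := fun h => if_neg fun h8 => by
    have := (Nat.Prime.pow_dvd_iff_le_factorization (k := 3) Nat.prime_two (NeZero.ne n)).1 h8
    omega
  w_eq := fun h => if_neg fun h4 => by
    have := (Nat.Prime.pow_dvd_iff_le_factorization (k := 2) Nat.prime_two (NeZero.ne n)).1 h4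
    omega

theorem exp_ofExp [NeZero n] (w : ℕ → ℕ) (hw : ∀ q, w q ≤ 1) {q : ℕ} (hq : q ∈ quadIndices n) :
    (ofExp w hw : DeltaParams n).exp q = w q := by
  rcases mem_quadIndices.1 hq with h | ⟨rfl, h⟩ | ⟨rfl, h⟩
  · rw [exp, if_neg (oddPrimes_ne_four h), if_neg (oddPrimes_ne_eight h)]
    rfl
  · simp [exp, ofExp, h]
  · simp [exp, ofExp, h]

theorem natAbs_quadDisc_oddPrime {p : ℕ} (hp : p ∈ oddPrimes n) : (quadDisc p).natAbs = p := by
  rw [quadDisc, if_neg (oddPrimes_ne_four hp), if_neg (oddPrimes_ne_eight hp), Int.natAbs_mul,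
    Int.natAbs_pow]
  simp

theorem isCoprime_quadDisc {q r : ℕ} (hq : q ∈ quadIndices n) (hr : r ∈ quadIndices n)
    (hne : q ≠ r) : IsCoprime (quadDisc q) (quadDisc r) := by
  rw [Int.isCoprime_iff_gcd_eq_one, Int.gcd_eq_natAbs]
  have d4 : (quadDisc 4).natAbs = 1 := by decide
  have d8 : (quadDisc 8).natAbs = 2 := by decide
  rcases mem_quadIndices.1 hq with h | ⟨rfl, h⟩ | ⟨rfl, h⟩
  · rcases mem_quadIndices.1 hr with h' | ⟨rfl, h'⟩ | ⟨rfl, h'⟩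
    · rw [natAbs_quadDisc_oddPrime h, natAbs_quadDisc_oddPrime h']
      exact (Nat.coprime_primes (oddPrimes_prime h) (oddPrimes_prime h')).2 hne
    · rw [d4, Nat.gcd_one_right]
    · rw [d8, natAbs_quadDisc_oddPrime h]
      exact (Nat.coprime_primes (oddPrimes_prime h) Nat.prime_two).2 (Finset.ne_of_mem_erase h)
  · rw [d4, Nat.gcd_one_left]
  · rcases mem_quadIndices.1 hr with h' | ⟨rfl, h'⟩ | ⟨rfl, h'⟩
    · rw [d8, natAbs_quadDisc_oddPrime h']
      exact (Nat.coprime_primes Nat.prime_two (oddPrimes_prime h')).2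
        (Finset.ne_of_mem_erase h').symm
    · rw [d4, Nat.gcd_one_right]
    · exact absurd rfl hne

theorem squarefree_delta (d : DeltaParams n) : Squarefree d.delta := by
  rw [delta_eq_prod]
  refine Finset.squarefree_prod_of_pairwise_isCoprime (fun q hq r hr hne => ?_) fun q hq => ?_
  · exact (isCoprime_quadDisc hq hr hne).pow.isRelPrime
  · have hs : Squarefree (quadDisc q) := by
      rw [← Int.squarefree_natAbs]
      rcases mem_quadIndices.1 hq with h | ⟨rfl, h⟩ | ⟨rfl, h⟩
      · rw [natAbs_quadDisc_oddPrime h]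
        exact (Nat.prime_iff.1 (oddPrimes_prime h)).squarefree
      · exact squarefree_one
      · exact (Nat.prime_iff.1 Nat.prime_two).squarefree
    have := d.exp_le q
    interval_cases d.exp q
    · simp
    · simpa using hs

theorem delta_ne_zero (d : DeltaParams n) : d.delta ≠ 0 := d.squarefree_delta.ne_zero

end DeltaParams

/-! ### Squarefree integers and complex square roots -/

/-- Squarefree integers whose product is a square are equal. -/
theorem eq_of_squarefree_of_mul_eq_sq {a b m : ℤ} (ha : Squarefree a) (hb : Squarefree b)
    (h : a * b = m ^ 2) : a = b := by
  -- Squarefreeness of `a` gives `m = a t`, so `b = t² a`; squarefreeness of `b` makes `t` a unit,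
  -- and `t² = 1` in `ℤ`.
  obtain ⟨t, rfl⟩ := (ha.dvd_pow_iff_dvd two_ne_zero).1 ⟨b, h.symm⟩
  have hb' : b = t * t * a := mul_left_cancel₀ ha.ne_zero (by rw [h]; ring)
  have ht := hb t (by rw [hb']; exact dvd_mul_right _ _)
  rw [hb', Int.isUnit_mul_self ht, one_mul]

/-- A rational number whose square is an integer is an integer. -/
theorem exists_int_of_sq_int {q : ℚ} {m : ℤ} (h : q ^ 2 = m) : ∃ z : ℤ, q = z := by
  have h1 : IsIntegral ℤ (q ^ 2) := by rw [h]; exact isIntegral_algebraMap (R := ℤ) (A := ℚ)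
  obtain ⟨z, hz⟩ := IsIntegrallyClosed.isIntegral_iff.1 (h1.of_pow (by norm_num))
  exact ⟨z, by rw [← hz]; simp⟩

/-- A rational number whose square times a squarefree integer is an integer is an integer. -/
theorem exists_int_of_sq_mul_squarefree {q : ℚ} {D m : ℤ} (hD : Squarefree D)
    (h : q ^ 2 * D = m) : ∃ z : ℤ, q = z := by
  obtain ⟨t, ht⟩ := exists_int_of_sq_int (q := q * D) (m := m * D) (by push_cast; rw [← h]; ring)
  have hDt : t ^ 2 = m * D := by
    have : ((t ^ 2 : ℤ) : ℚ) = ((m * D : ℤ) : ℚ) := by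
      push_cast
      rw [← ht, ← h]
      ring
    exact_mod_cast this
  obtain ⟨u, rfl⟩ := (hD.dvd_pow_iff_dvd two_ne_zero).1 (Dvd.intro_left _ hDt.symm)
  have hD0 : (D : ℚ) ≠ 0 := by exact_mod_cast hD.ne_zero
  refine ⟨u, mul_right_cancel₀ hD0 ?_⟩
  rw [ht]
  push_cast
  ring

theorem sqrtInt_sq (D : ℤ) : sqrtInt D ^ 2 = (D : ℂ) := by
  unfold sqrtInt
  split_ifs with h
  · rw [← Complex.ofReal_pow, Real.sq_sqrt (by exact_mod_cast h)]
    simp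
  · rw [mul_pow, Complex.I_sq, ← Complex.ofReal_pow, Real.sq_sqrt]
    · simp
    · have : (D : ℝ) < 0 := by exact_mod_cast not_le.1 h
      linarith

theorem conj_sqrtInt_of_nonneg {D : ℤ} (h : 0 ≤ D) :
    (starRingEnd ℂ) (sqrtInt D) = sqrtInt D := by
  rw [sqrtInt, if_pos h, Complex.conj_ofReal]

theorem conj_sqrtInt_of_neg {D : ℤ} (h : D < 0) :
    (starRingEnd ℂ) (sqrtInt D) = -sqrtInt D := by
  rw [sqrtInt, if_neg (not_le.2 h), map_mul, Complex.conj_I, Complex.conj_ofReal, neg_mul]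

theorem sqrt_delta_ne_zero {n : ℕ} {K : Type*} [Field K] [CharZero K] {d : DeltaParams n}
    {a : K} (ha : a ^ 2 = (d.delta : K)) : a ≠ 0 := by
  rintro rfl
  have : (d.delta : K) = 0 := by rw [← ha]; ring
  exact d.delta_ne_zero (by exact_mod_cast this)

/-! ### Quadratic subfields of the cyclotomic field -/

section Field

variable {n : ℕ} [NeZero n] {K : Type*} [Field K] [NumberField K] [IsCyclotomicExtension {n} ℚ K]

variable (K) in
theorem exists_sqrt_quadDisc {q : ℕ} (hq : q ∈ quadIndices n) :
    ∃ a : K, a ^ 2 = (quadDisc q : K) ∧ ∀ k : (ZMod n)ˣ,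
      cyclotomicAut K k a = (quadSign q (k : ZMod n).val : K) * a := by
  rcases mem_quadIndices.1 hq with h | ⟨rfl, h⟩ | ⟨rfl, h⟩
  · simp only [quadDisc, quadSign, if_neg (oddPrimes_ne_four h), if_neg (oddPrimes_ne_eight h)]
    exact exists_sqrt_oddPrime K h
  · exact exists_sqrt_neg_one K h
  · exact exists_sqrt_two K h

variable (K) in
theorem exists_sqrt_delta (d : DeltaParams n) :
    ∃ a : K, a ^ 2 = (d.delta : K) ∧ ∀ k : (ZMod n)ˣ, cyclotomicAut K k a = (d.sign k : K) * a := by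
  choose! a ha hσ using fun q => exists_sqrt_quadDisc (n := n) K (q := q)
  refine ⟨∏ q ∈ quadIndices n, a q ^ d.exp q, ?_, fun k => ?_⟩
  · rw [d.delta_eq_prod, ← Finset.prod_pow]
    push_cast
    refine Finset.prod_congr rfl fun q hq => ?_
    rw [pow_right_comm, ha q hq]
  · rw [d.sign_eq_prod, map_prod]
    push_cast
    rw [← Finset.prod_mul_distrib]
    refine Finset.prod_congr rfl fun q hq => ?_
    rw [map_pow, hσ q hq, mul_pow]

/-- The square root of `Δ` in the cyclotomic field, with the Galois action on it. -/
theorem exists_map_eq_sqrtInt_delta (ι : K →ₐ[ℚ] ℂ) (d : DeltaParams n) :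
    ∃ a : K, ι a = sqrtInt d.delta ∧ a ^ 2 = (d.delta : K) ∧
      ∀ k : (ZMod n)ˣ, cyclotomicAut K k a = (d.sign k : K) * a := by
  obtain ⟨a, ha, hσ⟩ := exists_sqrt_delta K d
  have h : ι a ^ 2 = sqrtInt d.delta ^ 2 := by rw [sqrtInt_sq, ← map_pow, ha, map_intCast]
  rcases sq_eq_sq_iff_eq_or_eq_neg.1 h with h | h
  · exact ⟨a, h, ha, hσ⟩
  · refine ⟨-a, by rw [map_neg, h, neg_neg], by rw [neg_sq, ha], fun k => ?_⟩
    rw [map_neg, hσ, mul_neg]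

/-- This is the Galois correspondence for `ℚ(a)`, whose image under `ι` is `ℚ(√D)`: an element lies
in it iff the stabilizer of `a` fixes it. -/
theorem map_mem_quadField_iff (ι : K →ₐ[ℚ] ℂ) {D : ℤ} {a : K} (ha : ι a = sqrtInt D) (x : K) :
    ι x ∈ quadField D ↔
      ∀ k : (ZMod n)ˣ, cyclotomicAut K k a = a → cyclotomicAut K k x = x := by
  have : IsGalois ℚ K := IsCyclotomicExtension.isGalois {n} ℚ K
  have e : quadField D = (IntermediateField.adjoin ℚ {a}).map ι := by
    rw [IntermediateField.adjoin_map, Set.image_singleton, ha, quadField]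
  have e2 : ι x ∈ quadField D ↔ x ∈ IntermediateField.adjoin ℚ {a} := by
    rw [e, IntermediateField.mem_map]
    constructor
    · rintro ⟨y, hy, hxy⟩
      rwa [← ι.toRingHom.injective hxy]
    · intro h
      exact ⟨x, h, rfl⟩
  have hfix : ∀ σ : K ≃ₐ[ℚ] K, σ ∈ (IntermediateField.adjoin ℚ {a}).fixingSubgroup ↔ σ a = a := by
    intro σ
    rw [IntermediateField.mem_fixingSubgroup_iff]
    have := IntermediateField.forall_mem_adjoin_smul_eq_self_iff ℚ (S := {a}) σ
    simpa using this
  rw [e2, ← IsGalois.fixedField_fixingSubgroup (IntermediateField.adjoin ℚ {a}),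
    IntermediateField.mem_fixedField_iff]
  constructor
  · intro h k hk
    exact h _ ((hfix _).2 hk)
  · intro h σ hσ
    obtain ⟨k, rfl⟩ := cyclotomicAut_surjective (n := n) σ
    exact h k ((hfix _).1 hσ)

theorem cyclotomicAut_sqrt_delta_eq_self_iff {d : DeltaParams n} {a : K}
    (ha : a ^ 2 = (d.delta : K))
    (hσ : ∀ k : (ZMod n)ˣ, cyclotomicAut K k a = (d.sign k : K) * a) (k : (ZMod n)ˣ) :
    cyclotomicAut K k a = a ↔ k ∈ d.H := by
  rw [hσ, mul_eq_right₀ (sqrt_delta_ne_zero ha)]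
  exact Int.cast_eq_one

theorem cyclotomicAut_sqrt_delta_of_notMem {d : DeltaParams n} {a : K}
    (ha : a ^ 2 = (d.delta : K))
    (hσ : ∀ k : (ZMod n)ˣ, cyclotomicAut K k a = (d.sign k : K) * a) {k : (ZMod n)ˣ}
    (hk : k ∉ d.H) : cyclotomicAut K k a = -a := by
  have h : (cyclotomicAut K k a) ^ 2 = a ^ 2 := by rw [← map_pow, ha, map_intCast]
  exact (sq_eq_sq_iff_eq_or_eq_neg.1 h).resolve_left
    fun h' => hk ((cyclotomicAut_sqrt_delta_eq_self_iff ha hσ k).1 h')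

/-- Otherwise `√Δ` would be fixed by the whole Galois group, hence rational, and a squarefree
perfect square is `1`. -/
theorem exists_notMem_H (d : DeltaParams n) (h : d.delta ≠ 1) : ∃ k : (ZMod n)ˣ, k ∉ d.H := by
  by_contra! hc
  have : NeZero (n : ℚ) := ⟨Nat.cast_ne_zero.2 (NeZero.ne n)⟩
  have : IsCyclotomicExtension {n} ℚ (CyclotomicField n ℚ) :=
    CyclotomicField.isCyclotomicExtension n ℚ
  obtain ⟨a, ha, hσ⟩ := exists_sqrt_delta (CyclotomicField n ℚ) d
  obtain ⟨q, rfl⟩ := exists_rat_of_fixed (K := CyclotomicField n ℚ)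
    fun k => (cyclotomicAut_sqrt_delta_eq_self_iff ha hσ k).2 (hc k)
  have h1 : q ^ 2 = ((d.delta : ℤ) : ℚ) := by exact_mod_cast ha
  obtain ⟨z, rfl⟩ := exists_int_of_sq_int h1
  have h2 : z ^ 2 = d.delta := by exact_mod_cast h1
  exact h (eq_of_squarefree_of_mul_eq_sq d.squarefree_delta squarefree_one
    (by rw [mul_one, h2]))

open Polynomial in
theorem finrank_quadField_le (D : ℤ) : Module.finrank ℚ (quadField D) ≤ 2 := by
  have hm : (X ^ 2 - C (D : ℚ) : ℚ[X]).Monic := monic_X_pow_sub_C _ two_ne_zero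
  have h0 : aeval (sqrtInt D) (X ^ 2 - C (D : ℚ) : ℚ[X]) = 0 := by
    simp [sqrtInt_sq]
  have hint : IsIntegral ℚ (sqrtInt D) := ⟨_, hm, h0⟩
  rw [quadField, IntermediateField.adjoin.finrank hint]
  have := minpoly.min ℚ _ hm h0
  rw [← natDegree_X_pow_sub_C (n := 2) (r := (D : ℚ))]
  exact natDegree_le_natDegree this

theorem finiteDimensional_quadField (D : ℤ) : FiniteDimensional ℚ (quadField D) := by
  refine IntermediateField.adjoin.finiteDimensional ?_
  refine IsIntegral.of_pow (n := 2) (by norm_num) ?_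
  rw [sqrtInt_sq]
  simpa using isIntegral_algebraMap (R := ℚ) (A := ℂ) (x := (D : ℚ))

/-- The quadratic subfields of the cyclotomic field are those of the integers `Δ`. -/
theorem exists_delta_eq (ι : K →ₐ[ℚ] ℂ) {D : ℤ} (hD : Squarefree D) {x : K}
    (hx : ι x ∈ quadField D) (hirr : ι x ∉ Set.range ((↑) : ℚ → ℂ)) :
    ∃ d : DeltaParams n, d.delta = D := by
  have hfd := finiteDimensional_quadField D
  have hle : IntermediateField.adjoin ℚ {ι x} ≤ quadField D := by
    rw [IntermediateField.adjoin_simple_le_iff]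
    exact hx
  -- An irrational element generates a field of degree at least two, and `ℚ(√D)` has degree at most
  -- two. This brings `√D` into the image of the cyclotomic field.
  have heq : IntermediateField.adjoin ℚ {ι x} = quadField D := by
    refine IntermediateField.eq_of_le_of_finrank_le hle ((finrank_quadField_le D).trans ?_)
    have h1 : Module.finrank ℚ (IntermediateField.adjoin ℚ {ι x}) ≠ 1 := by
      rw [Ne, IntermediateField.finrank_adjoin_simple_eq_one_iff, IntermediateField.mem_bot]
      rintro ⟨q, hq⟩
      exact hirr ⟨q, by rw [← hq]; simp⟩
    have : FiniteDimensional ℚ (IntermediateField.adjoin ℚ {ι x}) :=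
      Module.Finite.of_injective (IntermediateField.inclusion hle).toLinearMap
        (IntermediateField.inclusion hle).injective
    have h2 : 0 < Module.finrank ℚ (IntermediateField.adjoin ℚ {ι x}) := Module.finrank_pos
    omega
  have hs : sqrtInt D ∈ IntermediateField.adjoin ℚ {ι x} := by
    rw [heq]
    exact IntermediateField.mem_adjoin_simple_self ℚ _
  rw [show ({ι x} : Set ℂ) = ι '' {x} by simp, ← IntermediateField.adjoin_map,
    IntermediateField.mem_map] at hs
  obtain ⟨s, -, hs⟩ := hs
  have hs2 : s ^ 2 = (D : K) := by
    apply ι.toRingHom.injective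
    change ι (s ^ 2) = ι (D : K)
    rw [map_pow, hs, sqrtInt_sq, map_intCast]
  choose! a ha hσ using fun q => exists_sqrt_quadDisc (n := n) K (q := q)
  have hsign : ∀ {y : K} {m : ℤ}, y ^ 2 = (m : K) → ∀ σ : K ≃ₐ[ℚ] K, σ y = y ∨ σ y = -y := by
    intro y m hy σ
    refine sq_eq_sq_iff_eq_or_eq_neg.1 ?_
    rw [← map_pow, hy, map_intCast]
  -- If `k` fixes all basic square roots, all its quadratic signs are `1`, so `k = l²` modulo `n`;
  -- as `l` acts on `s = √D` by a sign, `k` fixes `s`.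
  obtain ⟨w, hw, hf⟩ := exists_prod_fixed_of_sign a (quadIndices n)
    (fun q hq => hsign (ha q hq)) s (hsign hs2) (fun σ h => by
      obtain ⟨k, rfl⟩ := cyclotomicAut_surjective (n := n) σ
      have hq1 : ∀ q ∈ quadIndices n, quadSign q (k : ZMod n).val = 1 := by
        intro q hq
        have h1 := h q hq
        have hne : a q ≠ 0 := by
          intro h0
          have h2 := ha q hq
          rw [h0] at h2
          have h3 : quadDisc q = 0 := by
            have : (quadDisc q : K) = 0 := by rw [← h2]; ring
            exact_mod_cast this
          rcases mem_quadIndices.1 hq with h | ⟨rfl, h⟩ | ⟨rfl, h⟩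
          · have h4 := DeltaParams.natAbs_quadDisc_oddPrime h
            rw [h3] at h4
            exact (oddPrimes_prime h).ne_zero h4.symm
          · exact absurd h3 (by decide)
          · exact absurd h3 (by decide)
        rw [hσ q hq, mul_eq_right₀ hne] at h1
        exact_mod_cast h1
      have hcop := ZMod.val_coe_unit_coprime k
      have h4 : 4 ∣ n → (k : ZMod n).val % 4 = 1 := by
        intro hn
        have := hq1 4 (mem_quadIndices.2 (Or.inr (Or.inl ⟨rfl, hn⟩)))
        rw [quadSign, if_pos rfl, ← ZMod.natCast_mod] at this
        have hlt : (k : ZMod n).val % 4 < 4 := Nat.mod_lt _ (by norm_num)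
        generalize (k : ZMod n).val % 4 = j at *
        interval_cases j
        · exact absurd this (by decide)
        · rfl
        · exact absurd this (by decide)
        · exact absurd this (by decide)
      have hsq : IsSquare (((k : ZMod n).val : ℕ) : ZMod n) := by
        refine isSquare_zmod hcop (fun p hp => ?_) h4 fun hn => ?_
        · have := hq1 p (mem_quadIndices.2 (Or.inl hp))
          rwa [quadSign, if_neg (oddPrimes_ne_four hp), if_neg (oddPrimes_ne_eight hp)] at this
        -- `χ₈` alone leaves the residues `1` and `7`; the character modulo `4` excludes `7`.
        · have h4' := h4 (Dvd.dvd.trans (by norm_num) hn)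
          have := hq1 8 (mem_quadIndices.2 (Or.inr (Or.inr ⟨rfl, hn⟩)))
          rw [quadSign, if_neg (by norm_num), if_pos rfl, ← ZMod.natCast_mod] at this
          have hlt : (k : ZMod n).val % 8 < 8 := Nat.mod_lt _ (by norm_num)
          have h41 : (k : ZMod n).val % 8 % 4 = 1 := by omega
          generalize (k : ZMod n).val % 8 = j at *
          interval_cases j <;> first | omega | rfl | exact absurd this (by decide)
      rw [ZMod.natCast_zmod_val] at hsq
      obtain ⟨y, hy⟩ := hsq
      have hyu : IsUnit y := isUnit_of_mul_isUnit_left (hy ▸ k.isUnit)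
      obtain ⟨l, rfl⟩ := hyu
      have hkl : k = l * l := Units.ext hy
      rw [hkl, cyclotomicAut_mul]
      rcases hsign hs2 (cyclotomicAut K l) with h1 | h1
      · rw [h1, h1]
      · rw [h1, map_neg, h1, neg_neg])
  obtain ⟨q, hq⟩ := exists_rat_of_fixed (n := n) (K := K) fun k => hf (cyclotomicAut K k)
  have hmul : D * (DeltaParams.ofExp w hw : DeltaParams n).delta =
      D * ∏ q ∈ quadIndices n, quadDisc q ^ w q := by
    rw [DeltaParams.delta_eq_prod]
    congr 1
    exact Finset.prod_congr rfl fun q hq => by rw [DeltaParams.exp_ofExp w hw hq]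
  -- Squaring the fixed element shows that `D Δ` is a rational square, hence an integral one; both
  -- factors are squarefree, so they agree.
  have hq2 : q ^ 2 = ((D * (DeltaParams.ofExp w hw : DeltaParams n).delta : ℤ) : ℚ) := by
    have : (q : K) ^ 2 = ((D * (DeltaParams.ofExp w hw : DeltaParams n).delta : ℤ) : K) := by
      rw [← hq, hmul, mul_pow, hs2, ← Finset.prod_pow]
      push_cast
      congr 1
      refine Finset.prod_congr rfl fun q hq => ?_
      rw [pow_right_comm, ha q hq]
    exact_mod_cast this
  obtain ⟨z, rfl⟩ := exists_int_of_sq_int hq2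
  exact ⟨_, (eq_of_squarefree_of_mul_eq_sq hD (DeltaParams.squarefree_delta _)
    (m := z) (by exact_mod_cast hq2.symm)).symm⟩

/-- An algebraic integer on which the Galois group acts as on `√Δ` is an integer multiple
of `√Δ`. -/
theorem exists_int_mul_sqrt {d : DeltaParams n} {a x : K} (ha : a ^ 2 = (d.delta : K))
    (hx : IsIntegral ℤ x)
    (h : ∀ k : (ZMod n)ˣ, cyclotomicAut K k a = a ∧ cyclotomicAut K k x = x ∨
      cyclotomicAut K k a = -a ∧ cyclotomicAut K k x = -x) : ∃ z : ℤ, x = z * a := by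
  have ha0 := sqrt_delta_ne_zero ha
  -- The signs cancel in `x / a`, so it is a rational `q`; then `q² Δ = x²` is a rational algebraic
  -- integer, hence an integer.
  obtain ⟨q, hq⟩ := exists_rat_of_fixed (n := n) (K := K) (x := x / a) fun k => by
    rw [map_div₀]
    rcases h k with ⟨h1, h2⟩ | ⟨h1, h2⟩
    · rw [h1, h2]
    · rw [h1, h2, neg_div_neg_eq]
  have hxq : x = q * a := by rw [← hq, div_mul_cancel₀ _ ha0]
  have h2 : x ^ 2 = ((q ^ 2 * (d.delta : ℚ) : ℚ) : K) := by
    rw [hxq, mul_pow, ha]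
    push_cast
    rfl
  have h3 : IsIntegral ℤ (q ^ 2 * (d.delta : ℚ) : ℚ) := by
    have h4 := hx.pow 2
    rw [h2] at h4
    exact (isIntegral_algebraMap_iff (R := ℤ) (A := ℚ) (B := K)
      (algebraMap ℚ K).injective).1 (by simpa using h4)
  obtain ⟨m, hm⟩ := IsIntegrallyClosed.isIntegral_iff.1 h3
  obtain ⟨z, rfl⟩ := exists_int_of_sq_mul_squarefree (q := q) (m := m) d.squarefree_delta
    (by rw [← hm]; simp)
  exact ⟨z, by rw [hxq]; simp⟩

/-- Complex conjugation acts on the cyclotomic field as the automorphism `-1`. -/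
theorem conj_map_cyclotomic (ι : K →ₐ[ℚ] ℂ) (x : K) :
    (starRingEnd ℂ) (ι x) = ι (cyclotomicAut K (-1 : (ZMod n)ˣ) x) := by
  have hz := IsCyclotomicExtension.zeta_spec n ℚ K
  let f : K →ₐ[ℚ] ℂ := (Complex.conjAe.toAlgHom.restrictScalars ℚ).comp ι
  let g : K →ₐ[ℚ] ℂ := ι.comp (cyclotomicAut K (-1 : (ZMod n)ˣ)).toAlgHom
  suffices f = g from DFunLike.congr_fun this x
  refine (hz.powerBasis ℚ).algHom_ext ?_
  rw [hz.powerBasis_gen ℚ]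
  change (starRingEnd ℂ) (ι _) = ι (cyclotomicAut K (-1 : (ZMod n)ˣ) _)
  have hι : (ι (IsCyclotomicExtension.zeta n ℚ K)) ^ n = 1 := by
    rw [← map_pow, hz.pow_eq_one, map_one]
  have hinv : cyclotomicAut K (-1 : (ZMod n)ˣ) (IsCyclotomicExtension.zeta n ℚ K) *
      IsCyclotomicExtension.zeta n ℚ K = 1 := by
    rw [cyclotomicAut_root _ hz.pow_eq_one, ← pow_succ]
    refine (hz.pow_eq_one_iff_dvd _).2 ?_
    rw [← ZMod.natCast_eq_zero_iff]
    push_cast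
    simp
  have h1 : ι (cyclotomicAut K (-1 : (ZMod n)ˣ) (IsCyclotomicExtension.zeta n ℚ K)) *
      ι (IsCyclotomicExtension.zeta n ℚ K) = 1 := by rw [← map_mul, hinv, map_one]
  rw [eq_inv_of_mul_eq_one_left h1]
  exact (Complex.inv_eq_conj (Complex.norm_eq_one_of_pow_eq_one hι (NeZero.ne n))).symm

end Field

/-! ### Traces of operators of finite order -/

open Polynomial in
theorem isSemisimple_of_pow_eq_one {W : Type*} [AddCommGroup W] [Module ℂ W] {n : ℕ} (hn : n ≠ 0)
    {f : Module.End ℂ W} (hf : f ^ n = 1) : f.IsSemisimple := by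
  refine Module.End.isSemisimple_of_squarefree_aeval_eq_zero (p := X ^ n - 1) ?_ (by simp [hf])
  exact (X_pow_sub_one_separable_iff.2 (Nat.cast_ne_zero.2 hn)).squarefree

/-- The traces of the powers of an operator of finite order are power sums of roots of unity. -/
theorem exists_trace_pow_eq_sum {W : Type*} [AddCommGroup W] [Module ℂ W] [FiniteDimensional ℂ W]
    {n : ℕ} (hn : n ≠ 0) {f : Module.End ℂ W} (hf : f ^ n = 1) :
    ∃ (S : Finset ℂ) (m : ℂ → ℕ), (∀ z ∈ S, z ^ n = 1) ∧
      ∀ k : ℕ, LinearMap.trace ℂ W (f ^ k) = ∑ z ∈ S, m z * z ^ k := by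
  have hss := isSemisimple_of_pow_eq_one hn hf
  have htop := hss.iSup_eigenspace_eq_top
  have hint := DirectSum.isInternal_submodule_of_iSupIndep_of_iSup_eq_top
    (f.eigenspaces_iSupIndep) htop
  have hfin : {z | f.eigenspace z ≠ ⊥}.Finite := WellFoundedGT.finite_ne_bot_of_iSupIndep
    f.eigenspaces_iSupIndep
  have hpow : ∀ (k : ℕ) (z : ℂ) (v : W), v ∈ f.eigenspace z → (f ^ k) v = z ^ k • v := by
    intro k z v hv
    induction k with
    | zero => simp
    | succ k ih =>
      rw [pow_succ', Module.End.mul_apply, ih, map_smul, Module.End.mem_eigenspace_iff.1 hv, smul_smul,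
        pow_succ]
  have hmaps : ∀ (k : ℕ) (z : ℂ), Set.MapsTo ⇑(f ^ k) (f.eigenspace z : Set W)
      (f.eigenspace z : Set W) := by
    intro k z v hv
    rw [hpow k z v hv]
    exact Submodule.smul_mem _ _ hv
  refine ⟨hfin.toFinset, fun z => Module.finrank ℂ (f.eigenspace z), fun z hz => ?_, fun k => ?_⟩
  · obtain ⟨v, hv, hv0⟩ := Submodule.exists_mem_ne_zero_of_ne_bot (hfin.mem_toFinset.1 hz)
    have h1 := hpow n z v hv
    rw [hf, Module.End.one_apply] at h1
    have h2 : (z ^ n - 1) • v = 0 := by rw [sub_smul, one_smul, ← h1, sub_self]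
    exact sub_eq_zero.1 ((smul_eq_zero.1 h2).resolve_right hv0)
  · rw [LinearMap.trace_eq_sum_trace_restrict' hint hfin (hmaps k)]
    refine Finset.sum_congr rfl fun z _ => ?_
    have : (f ^ k).restrict (hmaps k z) = z ^ k • LinearMap.id := by
      ext v
      exact hpow k z v v.2
    rw [this, map_smul, LinearMap.trace_id, smul_eq_mul, mul_comm]

section Field

variable {n : ℕ} [NeZero n] {K : Type*} [Field K] [NumberField K] [IsCyclotomicExtension {n} ℚ K]

theorem exists_map_eq_root (ι : K →ₐ[ℚ] ℂ) {z : ℂ} (hz : z ^ n = 1) :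
    ∃ x : K, x ^ n = 1 ∧ ι x = z := by
  have hζ := IsCyclotomicExtension.zeta_spec n ℚ K
  have hζ' := hζ.map_of_injective (f := ι) ι.toRingHom.injective
  obtain ⟨i, -, hi⟩ := hζ'.eq_pow_of_pow_eq_one hz
  exact ⟨IsCyclotomicExtension.zeta n ℚ K ^ i, by rw [pow_right_comm, hζ.pow_eq_one, one_pow],
    by rw [map_pow, hi]⟩

/-- The eigenvalues are `n`-th roots of unity with multiplicities independent of the power taken, so
applying `k` to the trace of `f` means replacing `f` by `f ^ k`. -/
theorem exists_map_eq_trace (ι : K →ₐ[ℚ] ℂ) {W : Type*} [AddCommGroup W] [Module ℂ W]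
    [FiniteDimensional ℂ W] {f : Module.End ℂ W} (hf : f ^ n = 1) :
    ∃ t : K, ι t = LinearMap.trace ℂ W f ∧ ∀ k : (ZMod n)ˣ,
      ι (cyclotomicAut K k t) = LinearMap.trace ℂ W (f ^ (k : ZMod n).val) := by
  obtain ⟨S, m, hS, htr⟩ := exists_trace_pow_eq_sum (NeZero.ne n) hf
  choose! x hx hιx using fun (z : ℂ) (hz : z ^ n = 1) => exists_map_eq_root (K := K) ι hz
  refine ⟨∑ z ∈ S, m z * x z, ?_, fun k => ?_⟩
  · rw [← pow_one f, htr, map_sum]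
    refine Finset.sum_congr rfl fun z hz => ?_
    rw [map_mul, map_natCast, hιx z (hS z hz), pow_one]
  · rw [htr, map_sum, map_sum]
    refine Finset.sum_congr rfl fun z hz => ?_
    rw [map_mul, map_mul, map_natCast, map_natCast, cyclotomicAut_root k (hx z (hS z hz)),
      map_pow, hιx z (hS z hz)]

/-- If a rational combination of operators of order dividing `n` is a scalar, then so is its Galois
conjugate, for the conjugate scalar. -/
theorem exists_map_eq_scalar (ι : K →ₐ[ℚ] ℂ) {W : Type*} [AddCommGroup W] [Module ℂ W]
    [FiniteDimensional ℂ W] [Nontrivial W] {X : Type*} [Fintype X] (ρ : X → Module.End ℂ W)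
    (hρ : ∀ g, ρ g ^ n = 1) (c : X → ℚ) {α β : ℂ} {k : (ZMod n)ˣ}
    (hα : ∑ g, (c g : ℂ) • ρ g = α • 1) (hβ : ∑ g, (c g : ℂ) • ρ g ^ (k : ZMod n).val = β • 1) :
    ∃ x : K, ι x = α ∧ ι (cyclotomicAut K k x) = β := by
  choose t ht ht' using fun g => exists_map_eq_trace (K := K) ι (hρ g)
  have hd : (Module.finrank ℂ W : ℂ) ≠ 0 := Nat.cast_ne_zero.2 Module.finrank_pos.ne'
  have hone : LinearMap.trace ℂ W 1 = Module.finrank ℂ W := LinearMap.trace_one ℂ W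
  have e1 := congrArg (LinearMap.trace ℂ W) hα
  have e2 := congrArg (LinearMap.trace ℂ W) hβ
  simp only [map_sum, map_smul, hone, smul_eq_mul] at e1 e2
  refine ⟨(∑ g, (c g : K) * t g) / Module.finrank ℂ W, ?_, ?_⟩
  · rw [map_div₀, map_sum, map_natCast, div_eq_iff hd, ← e1]
    exact Finset.sum_congr rfl fun g _ => by rw [map_mul, map_ratCast, ht]
  · rw [map_div₀, map_div₀, map_sum, map_sum, map_natCast, map_natCast, div_eq_iff hd, ← e2]
    exact Finset.sum_congr rfl fun g _ => by
      rw [map_mul, map_mul, map_ratCast, map_ratCast, ht']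

end Field

/-! ### Matrices of class functions and their eigenvalues -/

section Group

variable {G : Type*} [Group G]

/-- The matrix with entries `c (b a⁻¹)`. -/
def funMatrix (c : G → ℂ) : Matrix G G ℂ := Matrix.of fun a b => c (b * a⁻¹)

theorem funMatrix_injective : Function.Injective (funMatrix (G := G)) := by
  intro c d h
  funext g
  have := congrFun (congrFun h 1) g
  simpa [funMatrix] using this

/-- `c` is constant on conjugacy classes. -/
def IsClassFun {R : Type*} (c : G → R) : Prop := ∀ g h : G, c (h * g * h⁻¹) = c g

theorem IsClassFun.cast {c : G → ℚ} (hc : IsClassFun c) :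
    IsClassFun (fun g => (c g : ℂ)) := fun g h => by simp only [hc g h]

variable [Fintype G] [DecidableEq G]

-- Class functions are central for convolution: the substitution `x ↦ b x⁻¹ a` exchanges the two
-- factors up to conjugation inside `c`.
omit [DecidableEq G] in
theorem funMatrix_commute {c : G → ℂ} (hc : IsClassFun c) (d : G → ℂ) :
    Commute (funMatrix c) (funMatrix d) := by
  ext a b
  rw [Matrix.mul_apply, Matrix.mul_apply]
  refine Fintype.sum_equiv ((Equiv.inv G).trans ((Equiv.mulLeft b).trans (Equiv.mulRight a)))
    _ _ fun x => ?_
  simp only [funMatrix, Matrix.of_apply, Equiv.trans_apply, Equiv.inv_apply, Equiv.coe_mulLeft,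
    Equiv.coe_mulRight]
  have h2 : c (b * (b * x⁻¹ * a)⁻¹) = c (x * a⁻¹) := by
    rw [show b * (b * x⁻¹ * a)⁻¹ = b * (a⁻¹ * x) * b⁻¹ by group, hc,
      show x * a⁻¹ = a * (a⁻¹ * x) * a⁻¹ by group, hc]
  rw [h2, mul_comm]
  congr 2
  group

omit [Fintype G] in
theorem groupMatrix_eq_funMatrix (g : G) : groupMatrix g = funMatrix (Pi.single g 1) := by
  ext a b
  simp [groupMatrix, funMatrix, Pi.single_apply]

theorem funMatrix_eq_sum (c : G → ℂ) : funMatrix c = ∑ g, c g • groupMatrix g := by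
  ext a b
  simp [funMatrix, groupMatrix, Matrix.sum_apply]

theorem groupMatrix_mul (g h : G) : groupMatrix g * groupMatrix h = groupMatrix (h * g) := by
  ext a b
  rw [Matrix.mul_apply, Finset.sum_eq_single (g * a)]
  · simp only [groupMatrix, Matrix.of_apply, mul_inv_cancel_right, if_true, one_mul]
    congr 1
    rw [mul_inv_rev, ← mul_assoc, mul_inv_eq_iff_eq_mul]
  · intro x _ hx
    simp only [groupMatrix, Matrix.of_apply]
    rw [if_neg, zero_mul]
    rwa [mul_inv_eq_iff_eq_mul]
  · simp

omit [Fintype G] in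
theorem groupMatrix_one : groupMatrix (1 : G) = 1 := by
  ext a b
  simp only [groupMatrix, Matrix.of_apply, Matrix.one_apply, mul_inv_eq_one]
  exact if_congr eq_comm rfl rfl

theorem groupMatrix_pow (g : G) (k : ℕ) : groupMatrix g ^ k = groupMatrix (g ^ k) := by
  induction k with
  | zero => rw [pow_zero, pow_zero, groupMatrix_one]
  | succ k ih => rw [pow_succ, ih, groupMatrix_mul, pow_succ']

omit [DecidableEq G] in
theorem powUnit_bijective (k : (ZMod (Monoid.exponent G))ˣ) :
    Function.Bijective fun g : G => powUnit g k := by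
  refine Function.bijective_iff_has_inverse.2 ⟨fun g => powUnit g k⁻¹, fun g => ?_, fun g => ?_⟩
  · simp only [← powUnit_mul, mul_inv_cancel, powUnit_one]
  · simp only [← powUnit_mul, inv_mul_cancel, powUnit_one]

theorem exists_mem_eigenspace_of_ne_bot {V : Type*} [AddCommGroup V] [Module ℂ V]
    [FiniteDimensional ℂ V] {W : Submodule ℂ V} (hW : W ≠ ⊥) {f : Module.End ℂ V}
    (hf : ∀ v ∈ W, f v ∈ W) : ∃ α : ℂ, W ⊓ f.eigenspace α ≠ ⊥ := by
  have : Nontrivial W := Submodule.nontrivial_iff_ne_bot.2 hW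
  obtain ⟨α, hα⟩ := Module.End.exists_eigenvalue (f.restrict hf)
  obtain ⟨v, hv⟩ := hα.exists_hasEigenvector
  refine ⟨α, fun h => hv.2 ?_⟩
  have h1 := congrArg Subtype.val hv.apply_eq_smul
  have h2 : (v : V) ∈ W ⊓ f.eigenspace α := ⟨v.2, Module.End.mem_eigenspace_iff.2 h1⟩
  rw [h, Submodule.mem_bot] at h2
  exact Subtype.ext h2

/-- The eigenvalues of `∑ c(g) A_g` lie in the cyclotomic field, and their conjugates are the
eigenvalues of `∑ c(g) A_{g ^ k}`. -/
theorem exists_map_eq_eigenvalue {K : Type*} [Field K] [NumberField K]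
    [IsCyclotomicExtension {Monoid.exponent G} ℚ K] (ι : K →ₐ[ℚ] ℂ) {c b : G → ℚ}
    (hc : IsClassFun c) (hb : IsClassFun b) {k : (ZMod (Monoid.exponent G))ˣ}
    (hcb : ∀ g, b (powUnit g k) = c g) {v : G → ℂ} (hv : v ≠ 0) {α β : ℂ}
    (hα : (funMatrix fun g => (c g : ℂ)).mulVec v = α • v)
    (hβ : (funMatrix fun g => (b g : ℂ)).mulVec v = β • v) :
    ∃ x : K, ι x = α ∧ ι (cyclotomicAut K k x) = β := by
  set Tc : Module.End ℂ (G → ℂ) := Matrix.toLin' (funMatrix fun g => (c g : ℂ)) with hTc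
  set Tb : Module.End ℂ (G → ℂ) := Matrix.toLin' (funMatrix fun g => (b g : ℂ)) with hTb
  set L : G → Module.End ℂ (G → ℂ) := fun g => Matrix.toLin' (groupMatrix g) with hL
  -- Every `A_g` preserves `W`, because it commutes with matrices of class functions. On `W` the
  -- sums with coefficients `c` and `b` are scalars, as `exists_map_eq_scalar` requires.
  set W := Tc.eigenspace α ⊓ Tb.eigenspace β with hW
  have hcomm : ∀ {d : G → ℂ}, IsClassFun d → ∀ g v, Matrix.toLin' (funMatrix d) (L g v) =
      L g (Matrix.toLin' (funMatrix d) v) := by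
    intro d hd g v
    rw [hL]
    simp only [← Matrix.toLin'_mul_apply, groupMatrix_eq_funMatrix]
    rw [(funMatrix_commute hd _).eq]
  have hinv : ∀ g, ∀ v ∈ W, L g v ∈ W := by
    rintro g v ⟨h1, h2⟩
    rw [SetLike.mem_coe, Module.End.mem_eigenspace_iff] at h1 h2
    refine ⟨Module.End.mem_eigenspace_iff.2 ?_, Module.End.mem_eigenspace_iff.2 ?_⟩
    · rw [hTc, hcomm hc.cast, ← hTc, h1, map_smul]
    · rw [hTb, hcomm hb.cast, ← hTb, h2, map_smul]
  have hvW : v ∈ W := ⟨Module.End.mem_eigenspace_iff.2 hα, Module.End.mem_eigenspace_iff.2 hβ⟩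
  have : Nontrivial W := ⟨⟨⟨v, hvW⟩, 0, fun h => hv (congrArg Subtype.val h)⟩⟩
  have hLpow : ∀ g (j : ℕ), L g ^ j = L (g ^ j) := by
    intro g j
    rw [hL]
    simp only [← groupMatrix_pow, Matrix.toLin'_pow]
  have hrpow : ∀ g (j : ℕ), (L g).restrict (hinv g) ^ j = (L (g ^ j)).restrict (hinv (g ^ j)) := by
    intro g j
    rw [Module.End.pow_restrict]
    ext w
    simp [hLpow]
  refine exists_map_eq_scalar (n := Monoid.exponent G) ι (fun g => (L g).restrict (hinv g))
    (fun g => ?_) c ?_ ?_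
  · simp only [hrpow, Monoid.pow_exponent_eq_one]
    ext w
    simp [hL, groupMatrix_one]
  · ext1 w
    apply Subtype.ext
    have h1 := Module.End.mem_eigenspace_iff.1 w.2.1
    rw [hTc, funMatrix_eq_sum, map_sum] at h1
    simpa [hL, LinearMap.sum_apply] using h1
  · ext1 w
    apply Subtype.ext
    have h1 := Module.End.mem_eigenspace_iff.1 w.2.2
    -- Reindexing by the bijection `g ↦ g ^ k` turns `∑ b(g) A_g` into `∑ c(g) A_g ^ k`.
    rw [hTb, funMatrix_eq_sum, ← (powUnit_bijective k).sum_comp, map_sum] at h1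
    simp only [hcb] at h1
    simp only [hrpow]
    simpa [hL, LinearMap.sum_apply, powUnit] using h1

omit [DecidableEq G] in
open scoped ComplexOrder Classical in
/-- Class functions are determined by the joint eigenvectors of their matrices. -/
theorem eq_smul_of_joint_eigenvalues {c b : G → ℂ} (hc : IsClassFun c) (hb : IsClassFun b) (s : ℂ)
    (h : ∀ (v : G → ℂ) (α β : ℂ), v ≠ 0 → (funMatrix c).mulVec v = α • v →
      (funMatrix b).mulVec v = β • v → β = s * α) : b = s • c := by
  set D : G → ℂ := b - s • c with hD
  have hDm : funMatrix D = funMatrix b - s • funMatrix c := by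
    ext x y
    simp [funMatrix, hD]
  by_contra hne
  have hM : funMatrix D ≠ 0 := by
    intro h0
    refine hne (sub_eq_zero.1 (funMatrix_injective (a₁ := D) (a₂ := 0) ?_))
    rw [h0]
    ext x y
    simp [funMatrix]
  -- If `D ≠ 0`, the trace of `A = D* D` is nonzero, so `A` has an eigenvalue `μ ≠ 0`. Its
  -- eigenspace contains a joint eigenvector of `c` and `b`, which `D` kills by hypothesis,
  -- contradicting `μ ≠ 0`.
  set A := (funMatrix D).conjTranspose * funMatrix D with hA
  have hstar : (funMatrix D).conjTranspose = funMatrix fun g => star (D g⁻¹) := by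
    ext x y
    simp [funMatrix, Matrix.conjTranspose_apply]
  have hcomm : ∀ {d : G → ℂ}, IsClassFun d → Commute (funMatrix d) A := by
    intro d hd
    rw [hA, hstar]
    exact (funMatrix_commute hd _).mul_right (funMatrix_commute hd _)
  have htr : A.trace ≠ 0 := fun h0 => hM (Matrix.trace_conjTranspose_mul_self_eq_zero_iff.1 h0)
  obtain ⟨μ, hμ, hμ0⟩ : ∃ μ ∈ A.charpoly.roots, μ ≠ 0 := by
    by_contra! hc0
    rw [Matrix.trace_eq_sum_roots_charpoly, Multiset.sum_eq_zero hc0] at htr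
    exact htr rfl
  have hev : Module.End.HasEigenvalue (Matrix.toLin' A) μ := by
    rw [Module.End.hasEigenvalue_iff_mem_spectrum, Matrix.spectrum_toLin',
      Matrix.mem_spectrum_iff_isRoot_charpoly]
    exact Polynomial.isRoot_of_mem_roots hμ
  have hmap : ∀ {d : G → ℂ}, IsClassFun d → ∀ v ∈ Module.End.eigenspace (Matrix.toLin' A) μ,
      Matrix.toLin' (funMatrix d) v ∈ Module.End.eigenspace (Matrix.toLin' A) μ := by
    intro d hd v hv
    rw [Module.End.mem_eigenspace_iff] at hv ⊢
    rw [← Matrix.toLin'_mul_apply, ← (hcomm hd).eq, Matrix.toLin'_mul_apply, hv, map_smul]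
  obtain ⟨α, hα⟩ := exists_mem_eigenspace_of_ne_bot hev (hmap hc)
  obtain ⟨β, hβ⟩ := exists_mem_eigenspace_of_ne_bot hα (f := Matrix.toLin' (funMatrix b)) (by
    rintro v ⟨h1, h2⟩
    refine ⟨hmap hb v h1, ?_⟩
    rw [SetLike.mem_coe, Module.End.mem_eigenspace_iff] at h2 ⊢
    rw [← Matrix.toLin'_mul_apply, (funMatrix_commute hc b).eq, Matrix.toLin'_mul_apply, h2,
      map_smul])
  obtain ⟨v, ⟨⟨h1, h2⟩, h3⟩, hv0⟩ := Submodule.exists_mem_ne_zero_of_ne_bot hβ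
  rw [SetLike.mem_coe, Module.End.mem_eigenspace_iff, Matrix.toLin'_apply] at h1 h2 h3
  have hβα := h v α β hv0 h2 h3
  have hzero : (funMatrix D).mulVec v = 0 := by
    rw [hDm, Matrix.sub_mulVec, Matrix.smul_mulVec, h2, h3, hβα, smul_smul, sub_self]
  rw [hA, ← Matrix.mulVec_mulVec, hzero, Matrix.mulVec_zero] at h1
  exact (smul_ne_zero hμ0 hv0) h1.symm

omit [Group G] in
theorem exists_mulVec_of_mem_spectrum {M : Matrix G G ℂ} {θ : ℂ} (h : θ ∈ spectrum ℂ M) :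
    ∃ v : G → ℂ, v ≠ 0 ∧ M.mulVec v = θ • v := by
  rw [← Matrix.spectrum_toLin', ← Module.End.hasEigenvalue_iff_mem_spectrum] at h
  obtain ⟨v, hv⟩ := h.exists_hasEigenvector
  exact ⟨v, hv.2, hv.apply_eq_smul⟩

omit [Group G] in
theorem mem_spectrum_of_mulVec {M : Matrix G G ℂ} {θ : ℂ} {v : G → ℂ} (hv : v ≠ 0)
    (h : M.mulVec v = θ • v) : θ ∈ spectrum ℂ M := by
  rw [← Matrix.spectrum_toLin', ← Module.End.hasEigenvalue_iff_mem_spectrum]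
  exact Module.End.hasEigenvalue_of_hasEigenvector
    ⟨Module.End.mem_eigenspace_iff.2 h, hv⟩

theorem exists_map_eq_of_mem_spectrum {K : Type*} [Field K] [NumberField K]
    [IsCyclotomicExtension {Monoid.exponent G} ℚ K] (ι : K →ₐ[ℚ] ℂ) {c : G → ℚ}
    (hc : IsClassFun c) {θ : ℂ} (hθ : θ ∈ spectrum ℂ (funMatrix fun g => (c g : ℂ))) :
    ∃ x : K, ι x = θ := by
  obtain ⟨v, hv, h⟩ := exists_mulVec_of_mem_spectrum hθ
  obtain ⟨x, hx, -⟩ := exists_map_eq_eigenvalue ι hc hc (k := 1) (fun g => by rw [powUnit_one])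
    hv h h
  exact ⟨x, hx⟩

/-- The automorphism `k` multiplies all eigenvalues of `∑ c(g) A_g` by the sign `s` if and only if
the power map `g ↦ g ^ k` multiplies `c` by `s`. -/
theorem forall_cyclotomicAut_eq_iff {K : Type*} [Field K] [NumberField K]
    [IsCyclotomicExtension {Monoid.exponent G} ℚ K] (ι : K →ₐ[ℚ] ℂ) {c : G → ℚ}
    (hc : IsClassFun c) (k : (ZMod (Monoid.exponent G))ˣ) {s : ℚ} (hs : s * s = 1) :
    (∀ x : K, ι x ∈ spectrum ℂ (funMatrix fun g => (c g : ℂ)) → cyclotomicAut K k x = s * x) ↔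
      ∀ g, c (powUnit g k) = s * c g := by
  have hclass : ∀ l, IsClassFun fun g => c (powUnit g l) := by
    intro l g h
    have h1 : powUnit (h * g * h⁻¹) l = h * powUnit g l * h⁻¹ := by simp [powUnit, conj_pow]
    simp only [h1, hc _ h]
  constructor
  · intro h
    -- The inverse enters because the conjugates under `k` are eigenvalues of `∑ c(g) A_{g^k}`,
    -- whose coefficient function is `c` composed with `g ↦ g ^ k⁻¹`.
    have key := eq_smul_of_joint_eigenvalues hc.cast (hclass k⁻¹).cast s
      (fun v α β hv hα hβ => by
        obtain ⟨x, rfl, rfl⟩ := exists_map_eq_eigenvalue ι hc (hclass k⁻¹) (k := k)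
          (fun g => by rw [← powUnit_mul, mul_inv_cancel, powUnit_one]) hv hα hβ
        rw [h x (mem_spectrum_of_mulVec hv hα), map_mul, map_ratCast])
    intro g
    have h1 := congrFun key (powUnit g k)
    simp only [← powUnit_mul, mul_inv_cancel, powUnit_one, Pi.smul_apply, smul_eq_mul] at h1
    have h2 : c g = s * c (powUnit g k) := by exact_mod_cast h1
    rw [h2, ← mul_assoc, hs, one_mul]
  · intro h x hx
    obtain ⟨v, hv, hα⟩ := exists_mulVec_of_mem_spectrum hx
    have hb : IsClassFun fun g => s * c g := fun g h => by simp only [hc g h]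
    have hβ : (funMatrix fun g => ((s * c g : ℚ) : ℂ)).mulVec v = ((s : ℂ) * ι x) • v := by
      have e : (funMatrix fun g => ((s * c g : ℚ) : ℂ)) =
          (s : ℂ) • funMatrix fun g => (c g : ℂ) := by
        ext a b
        simp [funMatrix]
      rw [e, Matrix.smul_mulVec, hα, smul_smul]
    obtain ⟨y, hy, hy'⟩ := exists_map_eq_eigenvalue ι hc hb (k := k)
      (fun g => by rw [h, ← mul_assoc, hs, one_mul]) hv hα hβ
    obtain rfl : y = x := ι.toRingHom.injective hy
    apply ι.toRingHom.injective
    change ι _ = ι _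
    rw [hy', map_mul, map_ratCast]

end Group

/-! ### Unions of classes and the function `1_{C₁} - 1_{C₂}` -/

theorem isUnionOfClasses_iff {X : Type*} (r : Setoid X) (C : Set X) :
    IsUnionOfClasses r C ↔ ∀ x ∈ C, ∀ y, r x y → y ∈ C := by
  constructor
  · rintro ⟨S, hS, rfl⟩ x ⟨s, hs, hx⟩ y hxy
    obtain ⟨z, rfl⟩ := hS hs
    exact ⟨_, hs, r.trans (r.symm hxy) hx⟩
  · intro h
    refine ⟨{s | ∃ y ∈ C, s = {x | r x y}}, ?_, ?_⟩
    · rintro s ⟨y, -, rfl⟩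
      exact ⟨y, rfl⟩
    · ext x
      constructor
      · intro hx
        exact ⟨_, ⟨x, hx, rfl⟩, r.refl x⟩
      · rintro ⟨_, ⟨y, hy, rfl⟩, hxy⟩
        exact h y hy x (r.symm hxy)

section Group

variable {G : Type*} [Group G]

theorem isNormalSet_iff (C : Set G) : IsNormalSet C ↔ ∀ g ∈ C, ∀ h, h * g * h⁻¹ ∈ C := by
  rw [IsNormalSet, isUnionOfClasses_iff]
  constructor
  · intro H g hg h
    exact H g hg _ (isConj_iff.2 ⟨h, rfl⟩)
  · intro H g hg y hgy
    obtain ⟨h, rfl⟩ := isConj_iff.1 hgy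
    exact H g hg h

theorem isUnionOfClasses_deltaSetoid_iff [Finite G] (d : DeltaParams (Monoid.exponent G))
    {C : Set G} (hC : IsNormalSet C) :
    IsUnionOfClasses (deltaSetoid d) C ↔ ∀ k ∈ d.H, ∀ g ∈ C, powUnit g k ∈ C := by
  rw [isUnionOfClasses_iff]
  rw [IsNormalSet, isUnionOfClasses_iff] at hC
  constructor
  · intro H k hk g hg
    exact H g hg _ ((deltaSetoid d).symm ⟨k, hk, IsConj.refl _⟩)
  · intro H g hg y hgy
    obtain ⟨k, hk, hc⟩ := (deltaSetoid d).symm hgy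
    exact hC _ (H k hk g hg) _ hc.symm

theorem powUnit_mul_inv [Finite G] (g : G) (k : (ZMod (Monoid.exponent G))ˣ) :
    powUnit (powUnit g k) k⁻¹ = g := by
  rw [← powUnit_mul, mul_inv_cancel, powUnit_one]

theorem powUnit_neg_one [Finite G] (g : G) : powUnit g (-1) = g⁻¹ := by
  have h : powUnit g (-1) * g = 1 := by
    rw [powUnit, ← pow_succ]
    refine orderOf_dvd_iff_pow_eq_one.1 ((Monoid.order_dvd_exponent g).trans ?_)
    rw [← ZMod.natCast_eq_zero_iff]
    push_cast
    simp
  exact eq_inv_of_mul_eq_one_left h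

variable [DecidableEq G]

/-- The function `1` on `C₁`, `-1` on `C₂` and `0` elsewhere. -/
def pairFun (C₁ C₂ : Finset G) (g : G) : ℤ := if g ∈ C₁ then 1 else if g ∈ C₂ then -1 else 0

omit [Group G] in
theorem pairFun_eq_one_iff {C₁ C₂ : Finset G} {g : G} : pairFun C₁ C₂ g = 1 ↔ g ∈ C₁ := by
  unfold pairFun
  split_ifs <;> simp_all

omit [Group G] in
theorem pairFun_eq_neg_one_iff {C₁ C₂ : Finset G} (hd : Disjoint C₁ C₂) {g : G} :
    pairFun C₁ C₂ g = -1 ↔ g ∈ C₂ := by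
  unfold pairFun
  split_ifs with h1 h2
  · simpa using Finset.disjoint_left.1 hd h1
  · simpa using h2
  · simpa using h2

theorem connMatrix_eq_funMatrix (C : Finset G) :
    connMatrix C = funMatrix fun g => if g ∈ C then 1 else 0 := by
  ext a b
  simp [connMatrix, groupMatrix, funMatrix, Matrix.sum_apply]

theorem connMatrix_sub_eq_funMatrix {C₁ C₂ : Finset G} (hd : Disjoint C₁ C₂) :
    connMatrix C₁ - connMatrix C₂ = funMatrix fun g => ((pairFun C₁ C₂ g : ℚ) : ℂ) := by
  rw [connMatrix_eq_funMatrix, connMatrix_eq_funMatrix]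
  ext a b
  have : b * a⁻¹ ∈ C₁ → b * a⁻¹ ∉ C₂ := fun h => Finset.disjoint_left.1 hd h
  simp only [funMatrix, pairFun, Matrix.sub_apply, Matrix.of_apply]
  split_ifs <;> simp_all

omit [Group G] in
theorem pairFun_comp_eq_iff {C₁ C₂ D₁ D₂ : Finset G} (hC : Disjoint C₁ C₂) (hD : Disjoint D₁ D₂)
    (f : G → G) : (∀ g, pairFun C₁ C₂ (f g) = pairFun D₁ D₂ g) ↔
      ∀ g, (f g ∈ C₁ ↔ g ∈ D₁) ∧ (f g ∈ C₂ ↔ g ∈ D₂) := by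
  constructor
  · intro h g
    rw [← pairFun_eq_one_iff (C₂ := C₂), ← pairFun_eq_neg_one_iff hC, h g, pairFun_eq_one_iff,
      pairFun_eq_neg_one_iff hD]
    exact ⟨Iff.rfl, Iff.rfl⟩
  · intro h g
    unfold pairFun
    rw [if_congr (h g).1 rfl (if_congr (h g).2 rfl rfl)]

omit [Group G] in
theorem neg_pairFun {C₁ C₂ : Finset G} (hd : Disjoint C₁ C₂) (g : G) :
    -pairFun C₁ C₂ g = pairFun C₂ C₁ g := by
  have : g ∈ C₁ → g ∉ C₂ := fun h => Finset.disjoint_left.1 hd h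
  unfold pairFun
  split_ifs <;> simp_all

theorem exists_classFun_of_mem_boseMesner [Fintype G] {M : Matrix G G ℂ}
    (hM : M ∈ boseMesner G) : ∃ c : G → ℂ, IsClassFun c ∧ M = funMatrix c := by
  induction hM using Submodule.span_induction with
  | mem M hM =>
    obtain ⟨K, rfl⟩ := hM
    refine ⟨_, fun g h => ?_, connMatrix_eq_funMatrix _⟩
    have : ConjClasses.mk (h * g * h⁻¹) = ConjClasses.mk g :=
      ConjClasses.mk_eq_mk_iff_isConj.2 (isConj_iff.2 ⟨h⁻¹, by group⟩)
    simp [this]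
  | zero => exact ⟨0, fun _ _ => rfl, by ext; simp [funMatrix]⟩
  | add M N _ _ hM hN =>
    obtain ⟨c, hc, rfl⟩ := hM
    obtain ⟨d, hd, rfl⟩ := hN
    exact ⟨c + d, fun g h => by simp only [Pi.add_apply, hc g h, hd g h],
      by ext; simp [funMatrix]⟩
  | smul z M _ hM =>
    obtain ⟨c, hc, rfl⟩ := hM
    exact ⟨z • c, fun g h => by simp only [Pi.smul_apply, hc g h], by ext; simp [funMatrix]⟩

theorem isClassFun_pairFun [Fintype G] {C₁ C₂ : Finset G} (hd : Disjoint C₁ C₂)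
    (hM : connMatrix C₁ - connMatrix C₂ ∈ boseMesner G) : IsClassFun (pairFun C₁ C₂) := by
  obtain ⟨c, hc, h⟩ := exists_classFun_of_mem_boseMesner hM
  rw [connMatrix_sub_eq_funMatrix hd] at h
  have h' := funMatrix_injective h
  intro g x
  have h1 := hc g x
  simp only [← h'] at h1
  exact_mod_cast h1

theorem isNormalSet_of_isClassFun {C₁ C₂ : Finset G} (hd : Disjoint C₁ C₂)
    (hc : IsClassFun (pairFun C₁ C₂)) :
    IsNormalSet (C₁ : Set G) ∧ IsNormalSet (C₂ : Set G) := by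
  rw [isNormalSet_iff, isNormalSet_iff]
  refine ⟨fun g hg h => ?_, fun g hg h => ?_⟩
  · rw [Finset.mem_coe, ← pairFun_eq_one_iff (C₂ := C₂)] at hg ⊢
    rw [hc, hg]
  · rw [Finset.mem_coe, ← pairFun_eq_neg_one_iff hd] at hg ⊢
    rw [hc, hg]

variable [Fintype G]

omit [Group G] in
open Polynomial in
theorem isIntegral_of_mem_spectrum {N : Matrix G G ℤ} {θ : ℂ}
    (h : θ ∈ spectrum ℂ (N.map (Int.castRingHom ℂ))) : IsIntegral ℤ θ := by
  rw [Matrix.mem_spectrum_iff_isRoot_charpoly, Matrix.charpoly_map, IsRoot, eval_map] at h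
  exact ⟨N.charpoly, N.charpoly_monic, h⟩

theorem forall_pairFun_powUnit_iff {C₁ C₂ : Finset G} (hd : Disjoint C₁ C₂)
    (hc : IsClassFun (pairFun C₁ C₂)) (d : DeltaParams (Monoid.exponent G)) :
    (∀ k ∈ d.H, ∀ g, pairFun C₁ C₂ (powUnit g k) = pairFun C₁ C₂ g) ↔
      IsUnionOfClasses (deltaSetoid d) (C₁ : Set G) ∧
      IsUnionOfClasses (deltaSetoid d) (C₂ : Set G) := by
  obtain ⟨h1, h2⟩ := isNormalSet_of_isClassFun hd hc
  rw [isUnionOfClasses_deltaSetoid_iff d h1, isUnionOfClasses_deltaSetoid_iff d h2]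
  simp only [pairFun_comp_eq_iff hd hd]
  constructor
  · intro H
    exact ⟨fun k hk g hg => (H k hk g).1.2 hg, fun k hk g hg => (H k hk g).2.2 hg⟩
  · rintro ⟨H1, H2⟩ k hk g
    refine ⟨⟨fun h => ?_, H1 k hk g⟩, ⟨fun h => ?_, H2 k hk g⟩⟩
    · have := H1 k⁻¹ (d.H.inv_mem hk) _ h
      rwa [powUnit_mul_inv] at this
    · have := H2 k⁻¹ (d.H.inv_mem hk) _ h
      rwa [powUnit_mul_inv] at this

end Group

/-! ### The subgroup `H_Δ` as the stabilizer of `√Δ` -/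

/-- Both automorphisms negate `√Δ`, so their product fixes it; thus `H_Δ` has index at most two. -/
theorem DeltaParams.mul_mem_H {n : ℕ} [NeZero n] (d : DeltaParams n) {k l : (ZMod n)ˣ}
    (hk : k ∉ d.H) (hl : l ∉ d.H) : k * l ∈ d.H := by
  have : NeZero (n : ℚ) := ⟨Nat.cast_ne_zero.2 (NeZero.ne n)⟩
  have : IsCyclotomicExtension {n} ℚ (CyclotomicField n ℚ) :=
    CyclotomicField.isCyclotomicExtension n ℚ
  obtain ⟨a, ha, hσ⟩ := exists_sqrt_delta (CyclotomicField n ℚ) d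
  rw [← cyclotomicAut_sqrt_delta_eq_self_iff ha hσ, cyclotomicAut_mul,
    cyclotomicAut_sqrt_delta_of_notMem ha hσ hl, map_neg,
    cyclotomicAut_sqrt_delta_of_notMem ha hσ hk, neg_neg]

theorem DeltaParams.mem_H_of_delta_eq_one {n : ℕ} [NeZero n] (d : DeltaParams n)
    (h : d.delta = 1) (k : (ZMod n)ˣ) : k ∈ d.H := by
  have : NeZero (n : ℚ) := ⟨Nat.cast_ne_zero.2 (NeZero.ne n)⟩
  have : IsCyclotomicExtension {n} ℚ (CyclotomicField n ℚ) :=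
    CyclotomicField.isCyclotomicExtension n ℚ
  obtain ⟨a, ha, hσ⟩ := exists_sqrt_delta (CyclotomicField n ℚ) d
  rw [← cyclotomicAut_sqrt_delta_eq_self_iff ha hσ]
  rw [h, Int.cast_one] at ha
  rw [pow_two] at ha
  rcases mul_self_eq_one_iff.1 ha with rfl | rfl <;> simp

/-- The automorphism `-1` is complex conjugation, which fixes `√Δ` exactly when it is real. -/
theorem DeltaParams.neg_one_mem_H_iff {n : ℕ} [NeZero n] (d : DeltaParams n) :
    (-1 : (ZMod n)ˣ) ∈ d.H ↔ 0 < d.delta := by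
  have : NeZero (n : ℚ) := ⟨Nat.cast_ne_zero.2 (NeZero.ne n)⟩
  have : IsCyclotomicExtension {n} ℚ (CyclotomicField n ℚ) :=
    CyclotomicField.isCyclotomicExtension n ℚ
  let ι : CyclotomicField n ℚ →ₐ[ℚ] ℂ := IsAlgClosed.lift
  obtain ⟨a, hι, ha, hσ⟩ := exists_map_eq_sqrtInt_delta ι d
  have hconj := conj_map_cyclotomic (n := n) ι a
  rw [← cyclotomicAut_sqrt_delta_eq_self_iff ha hσ]
  constructor
  · intro h
    by_contra hneg
    have hlt : d.delta < 0 := lt_of_le_of_ne (not_lt.1 hneg) d.delta_ne_zero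
    rw [h, hι, conj_sqrtInt_of_neg hlt, neg_eq_self, ← hι] at hconj
    exact sqrt_delta_ne_zero ha (ι.toRingHom.injective (hconj.trans (map_zero ι).symm))
  · intro h
    rw [hι, conj_sqrtInt_of_nonneg h.le, ← hι] at hconj
    exact (ι.toRingHom.injective hconj).symm

/-! ### Spectral criteria for `A_{C₁} - A_{C₂}` -/

section Group

variable {G : Type*} [Group G] [Fintype G] [DecidableEq G]

variable {C₁ C₂ : Finset G}

theorem pairFun_powUnit_iff (hc : IsClassFun (pairFun C₁ C₂)) {K : Type*} [Field K] [NumberField K]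
    [IsCyclotomicExtension {Monoid.exponent G} ℚ K] (ι : K →ₐ[ℚ] ℂ)
    (k : (ZMod (Monoid.exponent G))ˣ) {s : ℤ} (hs : s * s = 1) :
    (∀ x : K, ι x ∈ spectrum ℂ (funMatrix fun g => ((pairFun C₁ C₂ g : ℚ) : ℂ)) →
      cyclotomicAut K k x = s * x) ↔
      ∀ g, pairFun C₁ C₂ (powUnit g k) = s * pairFun C₁ C₂ g := by
  have hc' : IsClassFun fun g => (pairFun C₁ C₂ g : ℚ) := fun g h => by simp only [hc g h]
  have := forall_cyclotomicAut_eq_iff ι hc' k (s := s) (by exact_mod_cast hs)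
  simp only [Rat.cast_intCast] at this ⊢
  rw [this]
  exact forall_congr' fun g => by exact_mod_cast Iff.rfl

theorem exists_map_eq_of_mem_spectrum_pairFun (hc : IsClassFun (pairFun C₁ C₂)) {K : Type*}
    [Field K] [NumberField K] [IsCyclotomicExtension {Monoid.exponent G} ℚ K] (ι : K →ₐ[ℚ] ℂ)
    {θ : ℂ} (h : θ ∈ spectrum ℂ (funMatrix fun g => ((pairFun C₁ C₂ g : ℚ) : ℂ))) :
    ∃ x : K, ι x = θ ∧ IsIntegral ℤ x := by
  have hc' : IsClassFun fun g => (pairFun C₁ C₂ g : ℚ) := fun g h => by simp only [hc g h]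
  obtain ⟨x, rfl⟩ := exists_map_eq_of_mem_spectrum ι hc' h
  have e : (funMatrix fun g => ((pairFun C₁ C₂ g : ℚ) : ℂ)) =
      (Matrix.of fun a b : G => pairFun C₁ C₂ (b * a⁻¹)).map (Int.castRingHom ℂ) := by
    ext a b
    simp [funMatrix]
  rw [e] at h
  exact ⟨x, rfl, (isIntegral_algHom_iff (ι.restrictScalars ℤ) ι.toRingHom.injective).1
    (isIntegral_of_mem_spectrum h)⟩

theorem spectrum_subset_quadField_iff (hd : Disjoint C₁ C₂)
    (hc : IsClassFun (pairFun C₁ C₂)) (d : DeltaParams (Monoid.exponent G)) :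
    (∀ θ ∈ spectrum ℂ (connMatrix C₁ - connMatrix C₂), θ ∈ quadField d.delta) ↔
      IsUnionOfClasses (deltaSetoid d) (C₁ : Set G) ∧
      IsUnionOfClasses (deltaSetoid d) (C₂ : Set G) := by
  rw [← forall_pairFun_powUnit_iff hd hc d, connMatrix_sub_eq_funMatrix hd]
  have : NeZero (Monoid.exponent G : ℚ) := ⟨Nat.cast_ne_zero.2 (NeZero.ne _)⟩
  have : IsCyclotomicExtension {Monoid.exponent G} ℚ (CyclotomicField (Monoid.exponent G) ℚ) :=
    CyclotomicField.isCyclotomicExtension _ ℚ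
  let ι : CyclotomicField (Monoid.exponent G) ℚ →ₐ[ℚ] ℂ := IsAlgClosed.lift
  obtain ⟨a, hι, ha, hσ⟩ := exists_map_eq_sqrtInt_delta ι d
  have key := fun k => pairFun_powUnit_iff hc ι k (s := 1) (one_mul 1)
  simp only [Int.cast_one, one_mul] at key
  simp only [← key]
  constructor
  · intro H k hk x hx
    exact (map_mem_quadField_iff (n := Monoid.exponent G) ι hι x).1 (H _ hx) k
      ((cyclotomicAut_sqrt_delta_eq_self_iff ha hσ k).2 hk)
  · intro H θ hθ
    obtain ⟨x, rfl, -⟩ := exists_map_eq_of_mem_spectrum_pairFun hc ι hθ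
    exact (map_mem_quadField_iff (n := Monoid.exponent G) ι hι x).2 fun k hk =>
      H k ((cyclotomicAut_sqrt_delta_eq_self_iff ha hσ k).1 hk) x hθ

/-- Integer multiples of `√Δ` are the algebraic integers on which Galois acts as on `√Δ`; this
action is read off on the group through power maps. -/
theorem spectrum_int_mul_sqrtInt_iff (hd : Disjoint C₁ C₂)
    (hc : IsClassFun (pairFun C₁ C₂)) (d : DeltaParams (Monoid.exponent G)) :
    (∀ θ ∈ spectrum ℂ (connMatrix C₁ - connMatrix C₂), ∃ z : ℤ, θ = z * sqrtInt d.delta) ↔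
      (∀ k ∈ d.H, ∀ g, pairFun C₁ C₂ (powUnit g k) = pairFun C₁ C₂ g) ∧
      (∀ k ∉ d.H, ∀ g, pairFun C₁ C₂ (powUnit g k) = -pairFun C₁ C₂ g) := by
  rw [connMatrix_sub_eq_funMatrix hd]
  have : NeZero (Monoid.exponent G : ℚ) := ⟨Nat.cast_ne_zero.2 (NeZero.ne _)⟩
  have : IsCyclotomicExtension {Monoid.exponent G} ℚ (CyclotomicField (Monoid.exponent G) ℚ) :=
    CyclotomicField.isCyclotomicExtension _ ℚ
  let ι : CyclotomicField (Monoid.exponent G) ℚ →ₐ[ℚ] ℂ := IsAlgClosed.lift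
  obtain ⟨a, hι, ha, hσ⟩ := exists_map_eq_sqrtInt_delta ι d
  have key := fun k => pairFun_powUnit_iff hc ι k (s := 1) (one_mul 1)
  have key' := fun k => pairFun_powUnit_iff hc ι k (s := -1) (by norm_num)
  simp only [Int.cast_one, one_mul] at key
  simp only [Int.cast_neg, Int.cast_one, neg_mul, one_mul] at key'
  simp only [← key, ← key']
  constructor
  · intro H
    have hmul : ∀ x, ι x ∈ spectrum ℂ (funMatrix fun g => ((pairFun C₁ C₂ g : ℚ) : ℂ)) →
        ∃ z : ℤ, x = z * a := by
      intro x hx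
      obtain ⟨z, hz⟩ := H _ hx
      refine ⟨z, ι.toRingHom.injective ?_⟩
      change ι x = ι (z * a)
      rw [hz, map_mul, map_intCast, hι]
    refine ⟨fun k hk x hx => ?_, fun k hk x hx => ?_⟩
    · obtain ⟨z, rfl⟩ := hmul x hx
      rw [map_mul, map_intCast, (cyclotomicAut_sqrt_delta_eq_self_iff ha hσ k).2 hk]
    · obtain ⟨z, rfl⟩ := hmul x hx
      rw [map_mul, map_intCast, cyclotomicAut_sqrt_delta_of_notMem ha hσ hk, mul_neg]
  · rintro ⟨H1, H2⟩ θ hθ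
    obtain ⟨x, rfl, hint⟩ := exists_map_eq_of_mem_spectrum_pairFun hc ι hθ
    obtain ⟨z, hz⟩ := exists_int_mul_sqrt ha hint fun k => by
      by_cases hk : k ∈ d.H
      · exact Or.inl ⟨(cyclotomicAut_sqrt_delta_eq_self_iff ha hσ k).2 hk, H1 k hk x hθ⟩
      · exact Or.inr ⟨cyclotomicAut_sqrt_delta_of_notMem ha hσ hk, H2 k hk x hθ⟩
    exact ⟨z, by rw [hz, map_mul, map_intCast, hι]⟩

theorem spectrum_int_mul_sqrtInt_iff_classes (hd : Disjoint C₁ C₂)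
    (hc : IsClassFun (pairFun C₁ C₂)) (d : DeltaParams (Monoid.exponent G)) :
    (∀ θ ∈ spectrum ℂ (connMatrix C₁ - connMatrix C₂), ∃ z : ℤ, θ = z * sqrtInt d.delta) ↔
      (d.delta = 1 ∧ IsUnionOfClasses (deltaSetoid d) (C₁ : Set G) ∧
        IsUnionOfClasses (deltaSetoid d) (C₂ : Set G)) ∨
      (d.delta ≠ 1 ∧
        (∃ k : (ZMod (Monoid.exponent G))ˣ, k ∉ d.H ∧
          (C₂ : Set G) = (fun g => powUnit g k) '' (C₁ : Set G)) ∧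
        IsUnionOfClasses (deltaSetoid d) (C₁ : Set G)) := by
  rw [spectrum_int_mul_sqrtInt_iff hd hc d, ← forall_pairFun_powUnit_iff hd hc d]
  by_cases h1 : d.delta = 1
  · simp only [h1, true_and, ne_eq, not_true_eq_false, false_and, or_false, and_iff_left_iff_imp]
    intro _ k hk
    exact absurd (d.mem_H_of_delta_eq_one h1 k) hk
  simp only [h1, false_and, false_or, ne_eq, not_false_eq_true, true_and, neg_pairFun hd,
    pairFun_comp_eq_iff hd hd.symm]
  constructor
  · rintro ⟨H1, H2⟩
    refine ⟨?_, ((forall_pairFun_powUnit_iff hd hc d).1 H1).1⟩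
    obtain ⟨k, hk⟩ := exists_notMem_H d h1
    refine ⟨k, hk, Set.ext fun y => ⟨fun hy => ?_, ?_⟩⟩
    · have hk' : k⁻¹ ∉ d.H := fun h => hk (inv_inv k ▸ d.H.inv_mem h)
      refine ⟨powUnit y k⁻¹, (H2 _ hk' y).1.2 hy, ?_⟩
      simpa using powUnit_mul_inv y k⁻¹
    · rintro ⟨g, hg, rfl⟩
      exact (H2 k hk g).2.2 hg
  · rintro ⟨⟨k, hk, hC⟩, hU⟩
    -- One `k` outside `H_Δ` controls all `l` outside it, since `l k⁻¹` and `k l` lie in `H_Δ`,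
    -- under which `C₁` is closed.
    have hmem2 : ∀ y, y ∈ C₂ ↔ ∃ g ∈ C₁, powUnit g k = y := fun y => by
      rw [← Finset.mem_coe, hC]
      rfl
    have hN := isNormalSet_of_isClassFun hd hc
    have hU1 := (isUnionOfClasses_deltaSetoid_iff d hN.1).1 hU
    have hU2 : ∀ l ∈ d.H, ∀ g ∈ C₂, powUnit g l ∈ C₂ := by
      intro l hl g hg
      obtain ⟨x, hx, rfl⟩ := (hmem2 g).1 hg
      refine (hmem2 _).2 ⟨powUnit x l, hU1 l hl x hx, ?_⟩
      rw [← powUnit_mul, ← powUnit_mul, mul_comm]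
    have h12 : ∀ l ∉ d.H, ∀ g ∈ C₁, powUnit g l ∈ C₂ := by
      intro l hl g hg
      have hk' : k⁻¹ ∉ d.H := fun h => hk (inv_inv k ▸ d.H.inv_mem h)
      refine (hmem2 _).2 ⟨powUnit g (l * k⁻¹), hU1 _ (d.mul_mem_H hl hk') g hg, ?_⟩
      rw [← powUnit_mul, inv_mul_cancel_right]
    have h21 : ∀ l ∉ d.H, ∀ g ∈ C₂, powUnit g l ∈ C₁ := by
      intro l hl g hg
      obtain ⟨x, hx, rfl⟩ := (hmem2 g).1 hg
      rw [← powUnit_mul]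
      exact hU1 _ (d.mul_mem_H hk hl) x hx
    refine ⟨(forall_pairFun_powUnit_iff hd hc d).2
      ⟨hU, (isUnionOfClasses_deltaSetoid_iff d hN.2).2 hU2⟩, fun l hl g => ?_⟩
    have hl' : l⁻¹ ∉ d.H := fun h => hl (inv_inv l ▸ d.H.inv_mem h)
    refine ⟨⟨fun h => ?_, h21 l hl g⟩, ⟨fun h => ?_, h12 l hl g⟩⟩
    · simpa [powUnit_mul_inv] using h12 _ hl' _ h
    · simpa [powUnit_mul_inv] using h21 _ hl' _ h

/-! ### Oriented and signed normal Cayley graphs -/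

omit [Fintype G] in
theorem isOrientedNormalCayleyMatrix_of_inv (hd : Disjoint C₁ C₂)
    (hc : IsClassFun (pairFun C₁ C₂)) (h : ∀ g, pairFun C₁ C₂ g⁻¹ = -pairFun C₁ C₂ g) :
    IsOrientedNormalCayleyMatrix (connMatrix C₁ - connMatrix C₂) (C₁ : Set G) := by
  simp only [neg_pairFun hd, pairFun_comp_eq_iff hd hd.symm] at h
  have hinv : ∀ u v : G, u * v⁻¹ ∈ C₁ ↔ v * u⁻¹ ∈ C₂ := fun u v => by
    have := (h (v * u⁻¹)).1
    rwa [mul_inv_rev, inv_inv] at this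
  refine ⟨(isNormalSet_of_isClassFun hd hc).1, fun u v huv hvu => ?_, ?_⟩
  · exact Finset.disjoint_left.1 hd huv ((hinv u v).1 hvu)
  · rw [connMatrix_sub_eq_funMatrix hd]
    ext u v
    simp only [funMatrix, skewAdjMatrix, cayleyDigraph, Matrix.of_apply, Finset.mem_coe, hinv,
      pairFun]
    split_ifs <;> simp

omit [Fintype G] in
theorem isSignedNormalCayleyMatrix_of_inv (hd : Disjoint C₁ C₂) (h1 : 1 ∉ C₁ ∪ C₂)
    (hc : IsClassFun (pairFun C₁ C₂)) (h : ∀ g, pairFun C₁ C₂ g⁻¹ = pairFun C₁ C₂ g) :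
    IsSignedNormalCayleyMatrix (connMatrix C₁ - connMatrix C₂) (C₁ : Set G) (C₂ : Set G) := by
  rw [pairFun_comp_eq_iff hd hd] at h
  obtain ⟨hN1, hN2⟩ := isNormalSet_of_isClassFun hd hc
  refine ⟨hN1, hN2, ⟨by simpa using h1, fun g hg => (h g).1.2 hg, fun g hg => (h g).2.2 hg,
    by exact_mod_cast hd⟩, ?_⟩
  rw [connMatrix_sub_eq_funMatrix hd]
  ext u v
  simp only [funMatrix, SignedGraph.adjMatrix, signedCayleyGraph, cayleyGraph, Matrix.of_apply,
    Finset.mem_coe, pairFun]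
  split_ifs <;> simp

-- Inversion invariance makes the matrix symmetric, while an oriented graph makes it skew-symmetric;
-- only zero is both.
omit [Fintype G] in
theorem eq_zero_of_isOrientedNormalCayleyMatrix (hd : Disjoint C₁ C₂)
    (h : ∀ g, pairFun C₁ C₂ g⁻¹ = pairFun C₁ C₂ g)
    (hM : IsOrientedNormalCayleyMatrix (connMatrix C₁ - connMatrix C₂) (C₁ : Set G)) :
    connMatrix C₁ - connMatrix C₂ = 0 := by
  obtain ⟨-, hor, hM⟩ := hM
  have hskew : ∀ u v, (connMatrix C₁ - connMatrix C₂) u v =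
      -(connMatrix C₁ - connMatrix C₂) v u := by
    intro u v
    rw [hM]
    simp only [skewAdjMatrix, Matrix.of_apply]
    have := hor u v
    split_ifs <;> simp_all
  ext u v
  have hs := hskew u v
  rw [connMatrix_sub_eq_funMatrix hd] at hs ⊢
  have h1 := h (v * u⁻¹)
  rw [mul_inv_rev, inv_inv] at h1
  simp only [funMatrix, Matrix.of_apply, h1] at hs ⊢
  exact self_eq_neg.1 hs

-- Here the roles are exchanged: the signed graph gives symmetry, the sign change under inversion
-- gives skew-symmetry.
omit [Fintype G] in
theorem eq_zero_of_isSignedNormalCayleyMatrix (hd : Disjoint C₁ C₂)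
    (h : ∀ g, pairFun C₁ C₂ g⁻¹ = -pairFun C₁ C₂ g)
    (hM : IsSignedNormalCayleyMatrix (connMatrix C₁ - connMatrix C₂) (C₁ : Set G) (C₂ : Set G)) :
    connMatrix C₁ - connMatrix C₂ = 0 := by
  obtain ⟨-, -, hS, hM⟩ := hM
  have hsymm : ∀ u v, (connMatrix C₁ - connMatrix C₂) u v =
      (connMatrix C₁ - connMatrix C₂) v u := by
    intro u v
    rw [hM]
    simp only [SignedGraph.adjMatrix, Matrix.of_apply]
    have h1 := (signedCayleyGraph (C₁ : Set G) C₂ hS).pos.adj_comm u v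
    have h2 := (signedCayleyGraph (C₁ : Set G) C₂ hS).neg.adj_comm u v
    split_ifs <;> simp_all
  ext u v
  have hs := hsymm u v
  rw [connMatrix_sub_eq_funMatrix hd] at hs ⊢
  have h1 := h (v * u⁻¹)
  rw [mul_inv_rev, inv_inv] at h1
  simp only [funMatrix, Matrix.of_apply, h1] at hs ⊢
  push_cast at hs
  exact self_eq_neg.1 hs

/-! ### Feasible square-free integers and the main theorem -/

theorem exists_delta_eq_of_feasible {D : ℤ} (hD : Squarefree D) {M : Matrix G G ℂ}
    (hM : M ∈ boseMesner G) (hent : ∀ a b, M a b = 0 ∨ M a b = 1 ∨ M a b = -1)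
    (hspec : ∀ θ ∈ spectrum ℂ M, θ ∈ quadField D)
    (hirr : D = 1 ∨ ∃ θ ∈ spectrum ℂ M, θ ∉ Set.range ((↑) : ℚ → ℂ)) :
    ∃ d : DeltaParams (Monoid.exponent G), d.delta = D := by
  rcases hirr with rfl | ⟨θ, hθ, hirr⟩
  -- For `D = 1` the spectrum gives no information; all exponents zero yield `Δ = 1`.
  · refine ⟨DeltaParams.ofExp 0 (by simp), ?_⟩
    rw [DeltaParams.delta_eq_prod]
    exact Finset.prod_eq_one fun q hq => by
      rw [DeltaParams.exp_ofExp _ _ hq, Pi.zero_apply, pow_zero]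
  have : NeZero (Monoid.exponent G : ℚ) := ⟨Nat.cast_ne_zero.2 (NeZero.ne _)⟩
  have : IsCyclotomicExtension {Monoid.exponent G} ℚ (CyclotomicField (Monoid.exponent G) ℚ) :=
    CyclotomicField.isCyclotomicExtension _ ℚ
  let ι : CyclotomicField (Monoid.exponent G) ℚ →ₐ[ℚ] ℂ := IsAlgClosed.lift
  obtain ⟨c, hc, rfl⟩ := exists_classFun_of_mem_boseMesner hM
  have hrat : ∀ g, ∃ q : ℚ, (q : ℂ) = c g := fun g => by
    have := hent 1 g
    simp only [funMatrix, Matrix.of_apply, inv_one, mul_one] at this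
    rcases this with h | h | h
    · exact ⟨0, by simp [h]⟩
    · exact ⟨1, by simp [h]⟩
    · exact ⟨-1, by simp [h]⟩
  choose q hq using hrat
  obtain rfl : (fun g => (q g : ℂ)) = c := funext hq
  have hc' : IsClassFun q := fun g h => by
    have := hc g h
    dsimp only at this
    exact_mod_cast this
  obtain ⟨x, rfl⟩ := exists_map_eq_of_mem_spectrum ι hc' hθ
  exact exists_delta_eq ι hD (hspec _ hθ) hirr

end Group

end NormalCayley

theorem mainTheorem2 (G : Type*) [Group G] [Fintype G] [DecidableEq G] :
    -- every feasible square-free integer has the stated form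
    (∀ D₀ : ℤ, Squarefree D₀ →
      (∃ M ∈ boseMesner G,
        (∀ a b, M a b = 0 ∨ M a b = 1 ∨ M a b = -1) ∧
        (∀ θ ∈ spectrum ℂ M, θ ∈ quadField D₀) ∧
        (D₀ = 1 ∨ ∃ θ ∈ spectrum ℂ M, θ ∉ Set.range ((↑) : ℚ → ℂ))) →
      ∃ d : DeltaParams (Monoid.exponent G), d.delta = D₀) ∧
    ∀ (d : DeltaParams (Monoid.exponent G)) (C₁ C₂ : Finset G), Disjoint C₁ C₂ →
      1 ∉ C₁ ∪ C₂ → connMatrix C₁ - connMatrix C₂ ∈ boseMesner G →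
      -- `C₁` and `C₂` are closed under conjugation
      (IsNormalSet (C₁ : Set G) ∧ IsNormalSet (C₂ : Set G)) ∧
      -- part (i)
      ((∀ θ ∈ spectrum ℂ (connMatrix C₁ - connMatrix C₂), θ ∈ quadField d.delta) ↔
        IsUnionOfClasses (deltaSetoid d) (C₁ : Set G) ∧
        IsUnionOfClasses (deltaSetoid d) (C₂ : Set G)) ∧
      -- part (ii)
      ((∀ θ ∈ spectrum ℂ (connMatrix C₁ - connMatrix C₂), ∃ z : ℤ, θ = z * sqrtInt d.delta) ↔
        (d.delta = 1 ∧ IsUnionOfClasses (deltaSetoid d) (C₁ : Set G) ∧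
          IsUnionOfClasses (deltaSetoid d) (C₂ : Set G)) ∨
        (d.delta ≠ 1 ∧
          (∃ k : (ZMod (Monoid.exponent G))ˣ, k ∉ d.H ∧
            (C₂ : Set G) = (fun g => powUnit g k) '' (C₁ : Set G)) ∧
          IsUnionOfClasses (deltaSetoid d) (C₁ : Set G))) ∧
      -- the sign of `Δ` decides between oriented and signed normal Cayley graphs
      ((∀ θ ∈ spectrum ℂ (connMatrix C₁ - connMatrix C₂), ∃ z : ℤ, θ = z * sqrtInt d.delta) →
        (d.delta < 0 → IsOrientedNormalCayleyMatrix (connMatrix C₁ - connMatrix C₂) (C₁ : Set G)) ∧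
        (0 < d.delta → IsSignedNormalCayleyMatrix (connMatrix C₁ - connMatrix C₂)
          (C₁ : Set G) (C₂ : Set G)) ∧
        (connMatrix C₁ - connMatrix C₂ ≠ 0 →
          (IsOrientedNormalCayleyMatrix (connMatrix C₁ - connMatrix C₂) (C₁ : Set G) →
            d.delta < 0) ∧
          (IsSignedNormalCayleyMatrix (connMatrix C₁ - connMatrix C₂)
            (C₁ : Set G) (C₂ : Set G) → 0 < d.delta))) := by
  refine ⟨fun D₀ hD ⟨M, hM, hent, hspec, hirr⟩ =>
    exists_delta_eq_of_feasible hD hM hent hspec hirr, fun d C₁ C₂ hd h1 hM => ?_⟩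
  have hc := isClassFun_pairFun hd hM
  refine ⟨isNormalSet_of_isClassFun hd hc, spectrum_subset_quadField_iff hd hc d,
    spectrum_int_mul_sqrtInt_iff_classes hd hc d, fun hspec => ?_⟩
  obtain ⟨H1, H2⟩ := (spectrum_int_mul_sqrtInt_iff hd hc d).1 hspec
  -- Inversion is the power map of `-1`, so membership of `-1` in `H_Δ` decides the symmetry type.
  have hpos : 0 < d.delta → ∀ g, pairFun C₁ C₂ g⁻¹ = pairFun C₁ C₂ g := fun h g => by
    rw [← powUnit_neg_one]
    exact H1 _ (d.neg_one_mem_H_iff.2 h) g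
  have hneg : d.delta < 0 → ∀ g, pairFun C₁ C₂ g⁻¹ = -pairFun C₁ C₂ g := fun h g => by
    rw [← powUnit_neg_one]
    exact H2 _ (fun hmem => lt_asymm h (d.neg_one_mem_H_iff.1 hmem)) g
  refine ⟨fun h => isOrientedNormalCayleyMatrix_of_inv hd hc (hneg h),
    fun h => isSignedNormalCayleyMatrix_of_inv hd h1 hc (hpos h), fun hM0 => ⟨fun hO => ?_,
    fun hS => ?_⟩⟩
  · refine d.delta_ne_zero.lt_or_gt.resolve_right fun h => hM0 ?_
    exact eq_zero_of_isOrientedNormalCayleyMatrix hd (hpos h) hO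
  · refine d.delta_ne_zero.lt_or_gt.resolve_left fun h => hM0 ?_
    exact eq_zero_of_isSignedNormalCayleyMatrix hd (hneg h) hS
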